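/- **Theorem 1.2 (with Remark 1.3).** Let $\mathbb T=\mathbb R/2\pi\mathbb Z$, $\mathbb T^2=[-\pi,\pi)^2$ and $S=\mathbb T\times[-\pi,\pi]$. The incompressible porous media (IPM) equation is $$\partial_t\rho+u\cdot\nabla\rho=0,\qquad \nabla\cdot u=0,\qquad u+\nabla p=-(0,\rho),$$ on $\Omega=\mathbb T^2$, or on $\Omega=S$ with the additional condition $u\cdot n=0$ for $x_2=\pm\pi$. A global smooth solution consists of functions $\rho,u,p$ on $[0,\infty)\times\Omega$, of class $C^\infty$ on $[0,\infty)\times\Omega$ (up to the boundary), that satisfy the equation for all $t\ge0$. For $f$ on $\mathbb T^2$ put $\hat f(k)=(2\pi)^{-2}\int_{\mathbb T^2}e^{-ik\cdot x}f(x)\,dx$ and $$\|f\|_{\dot H^s(\mathbb T^2)}^2=(2\pi)^2\sum_{k\in\mathbb Z^2\setminus\{0\}}|k|^{2s}|\hat f(k)|^2 .$$ For $f$ on $S$ put $$\|f\|_{\dot H^s(S)}^2=\int_S f\,(-\Delta_S)^s f\,dx=\sum_{m\in\mathbb Z,\ q\ge1}\Big(m^2+\frac{q^2}4\Big)^s\,\frac{|\langle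 f,\omega_{m,q}\rangle_{L^2(S)}|^2}{\|\omega_{m,q}\|_{L^2(S)}^2},$$ where $\Delta_S$ is the Dirichlet Laplacian with eigenfunctions $\omega_{m,q}(x)=e^{imx_1}b_q(x_2)$, $b_q(x_2)=\cos(qx_2/2)$ for $q$ odd and $b_q(x_2)=\sin(qx_2/2)$ for $q$ even. These norms take values in $[0,\infty]$, with $\infty^{-a}=0$ for $a>0$. *(Torus.)* Let $\rho_0\in C^\infty(\mathbb T^2)$, $\rho_0\not\equiv0$, be odd in $x_2$ and even in $x_1$, with $\rho_0=0$ for $x_1=0$ and $\rho_0\ge0$ in $[0,\pi]^2$. For every $s>-\frac12$ there is a constant $C(s,\rho_0)<\infty$ such that every global smooth solution of the IPM equation on $\mathbb T^2$ with initial data $\rho_0$ satisfies $$\int_0^\infty\|\partial_{x_1}\rho(t)\|_{\dot H^s(\mathbb T^2)}^{-\frac{2}{2s+1}}\,dt\le C(s,\rho_0)$$ and $$\limsup_{t\to\infty}t^{-(s+\frac12)}\|\rho(t)\|_{\dot H^{s+1}(\mathbb T^2)}\ \ge\ \limsup_{t\to\infty}t^{-(s+\frac12)}\|\partial_{x_1}\rho(t)\|_{\dot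 H^s(\mathbb T^2)}=\infty .$$ Moreover, every such solution, restricted to $S$, is a global smooth solution on $S$; in particular $u\cdot n=0$ for $x_2=\pm\pi$. *(Strip.)* Let $\rho_0\in C^\infty(S)$, $\rho_0\not\equiv0$, be odd in $x_2$ and even in $x_1$, with $\rho_0=0$ for $x_1=0$ and $\rho_0\ge0$ in $[0,\pi]^2$. For every $s>-\frac12$ there is a constant $C(s,\rho_0)<\infty$ such that every global smooth solution of the IPM equation on $S$ with initial data $\rho_0$ satisfies the same integral bound and the same two relations between upper limits, with $\dot H^s(S)$ and $\dot H^{s+1}(S)$ in place of $\dot H^s(\mathbb T^2)$ and $\dot H^{s+1}(\mathbb T^2)$. -/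

import Mathlib

open Real Set Filter MeasureTheory
open scoped ContDiff

noncomputable section

namespace IPM

/-- The partial derivative `∂f/∂x₁` of a scalar function of `x = (x₁, x₂)`. -/
def partial1 (f : ℝ × ℝ → ℝ) (x : ℝ × ℝ) : ℝ := deriv (fun y : ℝ => f (y, x.2)) x.1

/-- The partial derivative `∂f/∂x₂` of a scalar function of `x = (x₁, x₂)`. -/
def partial2 (f : ℝ × ℝ → ℝ) (x : ℝ × ℝ) : ℝ := deriv (fun y : ℝ => f (x.1, y)) x.2

/-- The time derivative `∂ρ/∂t (t, x)` for `t ∈ [0, ∞)` (one-sided at `t = 0`). -/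
def timeDeriv (ρ : ℝ → ℝ × ℝ → ℝ) (t : ℝ) (x : ℝ × ℝ) : ℝ :=
  derivWithin (fun τ : ℝ => ρ τ x) (Ici 0) t

/-! ### The torus `𝕋² = [-π, π)²`

Functions on the torus are functions on `ℝ²` that are `2π`-periodic in each variable. -/

/-- `f` is `2π`-periodic in `x₁`. -/
def Periodic1 {E : Type*} (f : ℝ × ℝ → E) : Prop := ∀ a b : ℝ, f (a + 2 * π, b) = f (a, b)

/-- `f` is `2π`-periodic in `x₂`. -/
def Periodic2 {E : Type*} (f : ℝ × ℝ → E) : Prop := ∀ a b : ℝ, f (a, b + 2 * π) = f (a, b)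

/-- The Fourier coefficient `f̂(k) = (2π)⁻² ∫_{𝕋²} e^{-i k·x} f(x) dx`. -/
def torusFourierCoeff (f : ℝ × ℝ → ℝ) (k : ℤ × ℤ) : ℂ :=
  ((2 * π) ^ 2 : ℂ)⁻¹ *
    ∫ x in Ico (-π) π ×ˢ Ico (-π) π,
      Complex.exp (-(Complex.I * ((k.1 : ℂ) * (x.1 : ℂ) + (k.2 : ℂ) * (x.2 : ℂ)))) * (f x : ℂ)

/-- The homogeneous Sobolev norm `‖f‖_{Ḣˢ(𝕋²)}`, with values in `[0, ∞]`:
`‖f‖² = (2π)² ∑_{k ≠ 0} |k|^{2s} |f̂(k)|²`. -/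
def torusHNorm (s : ℝ) (f : ℝ × ℝ → ℝ) : ENNReal :=
  (ENNReal.ofReal ((2 * π) ^ 2) *
    ∑' k : {k : ℤ × ℤ // k ≠ 0},
      ENNReal.ofReal
        ((((k.1.1 : ℝ) ^ 2 + (k.1.2 : ℝ) ^ 2) ^ s) * ‖torusFourierCoeff f k.1‖ ^ 2)) ^ (1 / 2 : ℝ)

/-- `(ρ, u, p)` is a global-in-time smooth solution on the torus of the incompressible porous
media equation `∂ₜρ + u·∇ρ = 0`, `∇·u = 0`, `u + ∇p = -(0, ρ)`. -/
structure IsTorusSolution (ρ : ℝ → ℝ × ℝ → ℝ) (u : ℝ → ℝ × ℝ → ℝ × ℝ) (p : ℝ → ℝ × ℝ → ℝ) :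
    Prop where
  smooth_ρ : ContDiffOn ℝ ∞ (fun q : ℝ × (ℝ × ℝ) => ρ q.1 q.2) (Ici 0 ×ˢ univ)
  smooth_u : ContDiffOn ℝ ∞ (fun q : ℝ × (ℝ × ℝ) => u q.1 q.2) (Ici 0 ×ˢ univ)
  smooth_p : ContDiffOn ℝ ∞ (fun q : ℝ × (ℝ × ℝ) => p q.1 q.2) (Ici 0 ×ˢ univ)
  periodic_ρ : ∀ t, 0 ≤ t → Periodic1 (ρ t) ∧ Periodic2 (ρ t)
  periodic_u : ∀ t, 0 ≤ t → Periodic1 (u t) ∧ Periodic2 (u t)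
  periodic_p : ∀ t, 0 ≤ t → Periodic1 (p t) ∧ Periodic2 (p t)
  transport : ∀ t, 0 ≤ t → ∀ x : ℝ × ℝ,
    timeDeriv ρ t x + ((u t x).1 * partial1 (ρ t) x + (u t x).2 * partial2 (ρ t) x) = 0
  div_free : ∀ t, 0 ≤ t → ∀ x : ℝ × ℝ,
    partial1 (fun y => (u t y).1) x + partial2 (fun y => (u t y).2) x = 0
  darcy1 : ∀ t, 0 ≤ t → ∀ x : ℝ × ℝ, (u t x).1 + partial1 (p t) x = 0
  darcy2 : ∀ t, 0 ≤ t → ∀ x : ℝ × ℝ, (u t x).2 + partial2 (p t) x = -ρ t x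

/-- Initial data on the torus: smooth, not identically zero, odd in `x₂`, even in `x₁`, zero for
`x₁ = 0`, and nonnegative in `[0, π]²`. -/
structure IsTorusData (ρ₀ : ℝ × ℝ → ℝ) : Prop where
  smooth : ContDiff ℝ ∞ ρ₀
  periodic : Periodic1 ρ₀ ∧ Periodic2 ρ₀
  nonzero : ∃ x, ρ₀ x ≠ 0
  odd2 : ∀ a b : ℝ, ρ₀ (a, -b) = -ρ₀ (a, b)
  even1 : ∀ a b : ℝ, ρ₀ (-a, b) = ρ₀ (a, b)
  zero_axis : ∀ b : ℝ, ρ₀ (0, b) = 0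
  nonneg : ∀ a ∈ Icc 0 π, ∀ b ∈ Icc 0 π, 0 ≤ ρ₀ (a, b)

/-! ### The strip `S = 𝕋 × [-π, π]`

Functions on the strip are functions that are `2π`-periodic in `x₁`, of which only the values with
`x₂ ∈ [-π, π]` matter. -/

/-- The closed strip `ℝ × [-π, π]` (the universal cover of `S`). -/
def strip : Set (ℝ × ℝ) := univ ×ˢ Icc (-π) π

/-- `f` is `2π`-periodic in `x₁` on the strip. -/
def StripPeriodic {E : Type*} (f : ℝ × ℝ → E) : Prop :=
  ∀ a : ℝ, ∀ b ∈ Icc (-π) π, f (a + 2 * π, b) = f (a, b)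

/-- The vertical factor of the eigenfunctions of `-Δ_S`: `cos(q x₂ / 2)` for `q` odd and
`sin(q x₂ / 2)` for `q` even. -/
def stripB (q : ℕ) (b : ℝ) : ℝ := if Odd q then cos (q * b / 2) else sin (q * b / 2)

/-- The inner product in `L²(S)` of `f` with the eigenfunction
`ω_{m,q}(x) = e^{i m x₁} b_q(x₂)` of the Dirichlet Laplacian `-Δ_S`, whose eigenvalue is
`m² + q²/4` and which satisfies `‖ω_{m,q}‖²_{L²(S)} = 2π²`. -/
def stripCoeff (f : ℝ × ℝ → ℝ) (m : ℤ) (q : ℕ) : ℂ :=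
  ∫ x in Ico (-π) π ×ˢ Icc (-π) π,
    Complex.exp (-(Complex.I * ((m : ℂ) * (x.1 : ℂ)))) * (stripB q x.2 : ℂ) * (f x : ℂ)

/-- The homogeneous Sobolev norm `‖f‖_{Ḣˢ(S)}`, with values in `[0, ∞]`, given by
`‖f‖² = ∫_S f (-Δ_S)ˢ f dx = ∑_{m ∈ ℤ, q ≥ 1} (m² + q²/4)ˢ |⟨f, ω_{m,q}⟩|² / ‖ω_{m,q}‖²`. -/
def stripHNorm (s : ℝ) (f : ℝ × ℝ → ℝ) : ENNReal :=
  (∑' k : ℤ × ℕ+,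
    ENNReal.ofReal
      (((k.1 : ℝ) ^ 2 + ((k.2 : ℕ) : ℝ) ^ 2 / 4) ^ s *
        (‖stripCoeff f k.1 (k.2 : ℕ)‖ ^ 2 / (2 * π ^ 2)))) ^ (1 / 2 : ℝ)

/-- `(ρ, u, p)` is a global-in-time solution on the strip, smooth up to the boundary, of the
incompressible porous media equation, with the no-flow condition `u·n = 0` for `x₂ = ±π`. -/
structure IsStripSolution (ρ : ℝ → ℝ × ℝ → ℝ) (u : ℝ → ℝ × ℝ → ℝ × ℝ) (p : ℝ → ℝ × ℝ → ℝ) :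
    Prop where
  smooth_ρ : ContDiffOn ℝ ∞ (fun q : ℝ × (ℝ × ℝ) => ρ q.1 q.2) (Ici 0 ×ˢ strip)
  smooth_u : ContDiffOn ℝ ∞ (fun q : ℝ × (ℝ × ℝ) => u q.1 q.2) (Ici 0 ×ˢ strip)
  smooth_p : ContDiffOn ℝ ∞ (fun q : ℝ × (ℝ × ℝ) => p q.1 q.2) (Ici 0 ×ˢ strip)
  periodic_ρ : ∀ t, 0 ≤ t → StripPeriodic (ρ t)
  periodic_u : ∀ t, 0 ≤ t → StripPeriodic (u t)
  periodic_p : ∀ t, 0 ≤ t → StripPeriodic (p t)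
  transport : ∀ t, 0 ≤ t → ∀ x ∈ interior strip,
    timeDeriv ρ t x + ((u t x).1 * partial1 (ρ t) x + (u t x).2 * partial2 (ρ t) x) = 0
  div_free : ∀ t, 0 ≤ t → ∀ x ∈ interior strip,
    partial1 (fun y => (u t y).1) x + partial2 (fun y => (u t y).2) x = 0
  darcy1 : ∀ t, 0 ≤ t → ∀ x ∈ interior strip, (u t x).1 + partial1 (p t) x = 0
  darcy2 : ∀ t, 0 ≤ t → ∀ x ∈ interior strip, (u t x).2 + partial2 (p t) x = -ρ t x
  no_flow : ∀ t, 0 ≤ t → ∀ a : ℝ, (u t (a, π)).2 = 0 ∧ (u t (a, -π)).2 = 0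

/-- Initial data on the strip: smooth up to the boundary, not identically zero, odd in `x₂`, even
in `x₁`, zero for `x₁ = 0`, and nonnegative in `[0, π]²`. -/
structure IsStripData (ρ₀ : ℝ × ℝ → ℝ) : Prop where
  smooth : ContDiffOn ℝ ∞ ρ₀ strip
  periodic : StripPeriodic ρ₀
  nonzero : ∃ x ∈ strip, ρ₀ x ≠ 0
  odd2 : ∀ a : ℝ, ∀ b ∈ Icc (-π) π, ρ₀ (a, -b) = -ρ₀ (a, b)
  even1 : ∀ a : ℝ, ∀ b ∈ Icc (-π) π, ρ₀ (-a, b) = ρ₀ (a, b)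
  zero_axis : ∀ b ∈ Icc (-π) π, ρ₀ (0, b) = 0
  nonneg : ∀ a ∈ Icc 0 π, ∀ b ∈ Icc 0 π, 0 ≤ ρ₀ (a, b)

end IPM

end

/-!
The potential energy `∫ ρ x₂` decreases exactly at the rate of the kinetic energy `∫ |u|²`
(`IsFlowFrom.integral_velocity_le`), and it stays nonnegative because the symmetries of the data and
the sign of the density in the quadrant `[0, π]²` persist. Hence `∫₀^∞ ‖u(t)‖² dt` is at most the
initial potential energy.

On the other hand, Darcy's law tested with the divergence-free fields
`(e^{-i k x₁} cos x₂, i k e^{-i k x₁} sin x₂)` (`darcy_modeCoeff`) shows that the nonzero Fourier modes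
of the vertical moment `f(x₁) = ∫ ρ sin x₂ dx₂` are bounded in `ℓ²` by `‖u‖`. So at most times `f` is
close to its mean in `L²`. But `f(0) = 0`, since the density keeps vanishing for `x₁ = 0`
(`IsFlowFrom.zero_axis`), while the mean of `f` is bounded below for all times
(`IsStripData.exists_moment_lower_bound`): the distribution function of the density in the quadrant is
conserved (`IsFlowFrom.integral_quadrant_comp`), so the mass cannot concentrate where `sin x₂` is
small. A function that is close to a nonzero constant in `L²` and vanishes at a point has a large
`Ḣ^{s+1}` seminorm when `s + 1 > 1 / 2`; the quantitative form is `exists_interpolation`, and it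
bounds `‖∂₁ρ‖_{Ḣˢ}^{-2/(2s+1)}` by a constant times `‖u‖²`. This is the integral bound, and it excludes
`‖∂₁ρ(t)‖_{Ḣˢ} = O(t^{s+1/2})` because `∫ dt / t` diverges (`limsup_eq_top_of_lintegral_lt_top`).

Only the modes `e^{i k x₁} sin x₂` enter the lower bound. They belong to both spectral families: they
are the strip eigenfunctions with `q = 2`, and combinations of the torus modes with `k₂ = ±1`. This
permits a common treatment of the two norms (`IsStripData.exists_growth`).

The symmetries persist by uniqueness (`IsFlow.unique`), an energy estimate for the difference of two
solutions which allows either boundary condition in `x₂`. On the torus it makes `u₂` odd in `x₂`;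
being also periodic, `u₂` vanishes for `x₂ = ±π`, which reduces the torus to the strip. All the energy
identities are instances of the divergence theorem on space-time boxes (`integral_div_box`).
-/

namespace IPM

/-! ### The divergence theorem on space-time boxes -/

theorem setIntegral_prod_flip {α β E : Type*} [MeasureSpace α] [MeasureSpace β]
    [SFinite (volume : Measure α)] [SFinite (volume : Measure β)] [NormedAddCommGroup E]
    [NormedSpace ℝ E] {s : Set α} {t : Set β} {f : α × β → E} (hf : IntegrableOn f (s ×ˢ t)) :
    ∫ z in s ×ˢ t, f z = ∫ y in t, ∫ x in s, f (x, y) := by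
  refine (setIntegral_prod_swap (μ := volume) (ν := volume) s t _).symm.trans ?_
  exact setIntegral_prod (fun z : β × α => f z.swap) hf.swap

/-- The space-time box `[0, T] × [a₁, b₁] × [a₂, b₂]`. -/
def box (T a₁ b₁ a₂ b₂ : ℝ) : Set (ℝ × ℝ × ℝ) := Icc 0 T ×ˢ (Icc a₁ b₁ ×ˢ Icc a₂ b₂)

/-- The time derivative of a function of `(t, x₁, x₂)`. -/
noncomputable def dT (F : ℝ × ℝ × ℝ → ℝ) (q : ℝ × ℝ × ℝ) : ℝ := fderiv ℝ F q (1, 0, 0)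

/-- The `x₁`-derivative of a function of `(t, x₁, x₂)`. -/
noncomputable def dX (F : ℝ × ℝ × ℝ → ℝ) (q : ℝ × ℝ × ℝ) : ℝ := fderiv ℝ F q (0, 1, 0)

/-- The `x₂`-derivative of a function of `(t, x₁, x₂)`. -/
noncomputable def dY (F : ℝ × ℝ × ℝ → ℝ) (q : ℝ × ℝ × ℝ) : ℝ := fderiv ℝ F q (0, 0, 1)

section Box

variable {T a₁ b₁ a₂ b₂ : ℝ}

theorem interior_box :
    interior (box T a₁ b₁ a₂ b₂) = Ioo 0 T ×ˢ (Ioo a₁ b₁ ×ˢ Ioo a₂ b₂) := by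
  rw [box, interior_prod_eq, interior_prod_eq, interior_Icc, interior_Icc, interior_Icc]

theorem isCompact_box : IsCompact (box T a₁ b₁ a₂ b₂) :=
  isCompact_Icc.prod (isCompact_Icc.prod isCompact_Icc)

theorem convex_box : Convex ℝ (box T a₁ b₁ a₂ b₂) :=
  (convex_Icc _ _).prod ((convex_Icc _ _).prod (convex_Icc _ _))

theorem interior_box_nonempty (hT : 0 < T) (h₁ : a₁ < b₁) (h₂ : a₂ < b₂) :
    (interior (box T a₁ b₁ a₂ b₂)).Nonempty := by
  rw [interior_box]
  exact (nonempty_Ioo.2 hT).prod ((nonempty_Ioo.2 h₁).prod (nonempty_Ioo.2 h₂))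

theorem ae_mem_interior_box :
    ∀ᵐ q ∂(volume.restrict (box T a₁ b₁ a₂ b₂)), q ∈ interior (box T a₁ b₁ a₂ b₂) := by
  have : (volume : Measure (ℝ × ℝ)).IsAddHaarMeasure := Measure.prod.instIsAddHaarMeasure _ _
  have : (volume : Measure (ℝ × ℝ × ℝ)).IsAddHaarMeasure :=
    Measure.prod.instIsAddHaarMeasure _ _
  have h : volume (frontier (box T a₁ b₁ a₂ b₂)) = 0 := convex_box.addHaar_frontier volume
  rw [ae_restrict_iff' isCompact_box.measurableSet]
  filter_upwards [measure_eq_zero_iff_ae_notMem.1 h] with q hq hqK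
  by_contra hc
  exact hq ⟨subset_closure hqK, hc⟩

/-- The fundamental theorem of calculus along a segment `φ` in a set on which `F` is `C¹`. -/
theorem integral_fderivWithin_segment {E : Type*} [NormedAddCommGroup E] [NormedSpace ℝ E]
    {F : E → ℝ} {K : Set E} (hK : UniqueDiffOn ℝ K) (hF : ContDiffOn ℝ 1 F K) {a b : ℝ}
    (hab : a ≤ b) {φ : ℝ → E} {e : E} (hφ : ∀ x, HasDerivAt φ e x) (hm : MapsTo φ (Icc a b) K) :
    ∫ x in Icc a b, fderivWithin ℝ F K (φ x) e = F (φ b) - F (φ a) := by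
  have hφc : ContinuousOn φ (Icc a b) := fun x _ => (hφ x).continuousAt.continuousWithinAt
  have hc : ContinuousOn (fun x => fderivWithin ℝ F K (φ x) e) (Icc a b) :=
    ((hF.continuousOn_fderivWithin hK le_rfl).comp hφc hm).clm_apply continuousOn_const
  rw [integral_Icc_eq_integral_Ioc, ← intervalIntegral.integral_of_le hab]
  refine intervalIntegral.integral_eq_sub_of_hasDerivAt_of_le hab
    (f := fun x => F (φ x)) (hF.continuousOn.comp hφc hm) (fun x hx => ?_) ?_
  · have h1 := ((hF.differentiableOn one_ne_zero) (φ x)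
      (hm (Ioo_subset_Icc_self hx))).hasFDerivWithinAt
    have h2 := h1.comp_hasDerivWithinAt x (hφ x).hasDerivWithinAt hm
    exact h2.hasDerivAt (Icc_mem_nhds hx.1 hx.2)
  · exact (hc.mono (by rw [uIcc_of_le hab])).intervalIntegrable

/-- The divergence theorem on a space-time box, for a field whose fluxes through opposite spatial
faces cancel. -/
theorem integral_div_box (hT : 0 < T) (h₁ : a₁ < b₁) (h₂ : a₂ < b₂) {F₀ F₁ F₂ g : ℝ × ℝ × ℝ → ℝ}
    (hF₀ : ContDiffOn ℝ 1 F₀ (box T a₁ b₁ a₂ b₂)) (hF₁ : ContDiffOn ℝ 1 F₁ (box T a₁ b₁ a₂ b₂))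
    (hF₂ : ContDiffOn ℝ 1 F₂ (box T a₁ b₁ a₂ b₂))
    (hp₁ : ∀ t ∈ Icc 0 T, ∀ y ∈ Icc a₂ b₂, F₁ (t, b₁, y) = F₁ (t, a₁, y))
    (hp₂ : ∀ t ∈ Icc 0 T, ∀ x ∈ Icc a₁ b₁, F₂ (t, x, b₂) = F₂ (t, x, a₂))
    (hg : ∀ q ∈ interior (box T a₁ b₁ a₂ b₂), dT F₀ q + dX F₁ q + dY F₂ q = g q) :
    IntegrableOn g (box T a₁ b₁ a₂ b₂) ∧
      ∫ q in box T a₁ b₁ a₂ b₂, g q =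
        (∫ x in Icc a₁ b₁ ×ˢ Icc a₂ b₂, F₀ (T, x)) - ∫ x in Icc a₁ b₁ ×ˢ Icc a₂ b₂, F₀ (0, x) := by
  set K := box T a₁ b₁ a₂ b₂ with hKdef
  have hK : UniqueDiffOn ℝ K := uniqueDiffOn_convex convex_box (interior_box_nonempty hT h₁ h₂)
  have hcont : ∀ {F : ℝ × ℝ × ℝ → ℝ}, ContDiffOn ℝ 1 F K → ∀ e,
      ContinuousOn (fun q => fderivWithin ℝ F K q e) K := fun hF e =>
    (hF.continuousOn_fderivWithin hK le_rfl).clm_apply continuousOn_const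
  have hint : ∀ {F : ℝ × ℝ × ℝ → ℝ}, ContDiffOn ℝ 1 F K → ∀ e,
      IntegrableOn (fun q => fderivWithin ℝ F K q e) K := fun hF e =>
    (hcont hF e).integrableOn_compact isCompact_box
  have hae : g =ᵐ[volume.restrict K] fun q => fderivWithin ℝ F₀ K q (1, 0, 0) +
      fderivWithin ℝ F₁ K q (0, 1, 0) + fderivWithin ℝ F₂ K q (0, 0, 1) := by
    filter_upwards [ae_mem_interior_box] with q hq
    have hn : K ∈ nhds q := mem_interior_iff_mem_nhds.1 hq
    rw [← hg q hq, fderivWithin_of_mem_nhds hn, fderivWithin_of_mem_nhds hn,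
      fderivWithin_of_mem_nhds hn]
    rfl
  have i0 : ∫ q in K, fderivWithin ℝ F₀ K q (1, 0, 0) =
      (∫ x in Icc a₁ b₁ ×ˢ Icc a₂ b₂, F₀ (T, x)) - ∫ x in Icc a₁ b₁ ×ˢ Icc a₂ b₂, F₀ (0, x) := by
    have hsl : ∀ t ∈ Icc 0 T, IntegrableOn (fun x => F₀ (t, x)) (Icc a₁ b₁ ×ˢ Icc a₂ b₂) := by
      intro t ht
      refine ContinuousOn.integrableOn_compact (isCompact_Icc.prod isCompact_Icc) ?_
      exact hF₀.continuousOn.comp (by fun_prop) (fun x hx => ⟨ht, hx⟩)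
    rw [← integral_sub (hsl T ⟨hT.le, le_rfl⟩) (hsl 0 ⟨le_rfl, hT.le⟩)]
    have hI := hint hF₀ (1, 0, 0)
    refine (setIntegral_prod_flip hI).trans ?_
    refine setIntegral_congr_fun (measurableSet_Icc.prod measurableSet_Icc) (fun x hx => ?_)
    refine integral_fderivWithin_segment hK hF₀ hT.le (φ := fun t => (t, x)) (fun t => ?_)
      (fun t ht => ⟨ht, hx⟩)
    exact (hasDerivAt_id t).prodMk (hasDerivAt_const t x)
  have i1 : ∫ q in K, fderivWithin ℝ F₁ K q (0, 1, 0) = 0 := by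
    have hI := hint hF₁ (0, 1, 0)
    refine (setIntegral_prod (μ := volume) (ν := volume) (s := Icc 0 T)
      (t := Icc a₁ b₁ ×ˢ Icc a₂ b₂) _ hI).trans ?_
    refine setIntegral_eq_zero_of_forall_eq_zero fun t ht => ?_
    have hsl : IntegrableOn (fun x => fderivWithin ℝ F₁ K (t, x) (0, 1, 0))
        (Icc a₁ b₁ ×ˢ Icc a₂ b₂) := by
      refine ContinuousOn.integrableOn_compact (isCompact_Icc.prod isCompact_Icc) ?_
      exact (hcont hF₁ _).comp (f := fun x => (t, x)) (by fun_prop) (fun x hx => ⟨ht, hx⟩)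
    change ∫ x in Icc a₁ b₁ ×ˢ Icc a₂ b₂, fderivWithin ℝ F₁ K (t, x) (0, 1, 0) = 0
    rw [setIntegral_prod_flip hsl]
    refine setIntegral_eq_zero_of_forall_eq_zero fun y hy => ?_
    refine (integral_fderivWithin_segment hK hF₁ h₁.le (φ := fun x => (t, x, y)) (fun x => ?_)
        (fun x hx => ⟨ht, hx, hy⟩)).trans (sub_eq_zero.2 (hp₁ t ht y hy))
    exact (hasDerivAt_const x t).prodMk ((hasDerivAt_id x).prodMk (hasDerivAt_const x y))
  have i2 : ∫ q in K, fderivWithin ℝ F₂ K q (0, 0, 1) = 0 := by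
    have hI := hint hF₂ (0, 0, 1)
    refine (setIntegral_prod (μ := volume) (ν := volume) (s := Icc 0 T)
      (t := Icc a₁ b₁ ×ˢ Icc a₂ b₂) _ hI).trans ?_
    refine setIntegral_eq_zero_of_forall_eq_zero fun t ht => ?_
    have hsl : IntegrableOn (fun x => fderivWithin ℝ F₂ K (t, x) (0, 0, 1))
        (Icc a₁ b₁ ×ˢ Icc a₂ b₂) := by
      refine ContinuousOn.integrableOn_compact (isCompact_Icc.prod isCompact_Icc) ?_
      exact (hcont hF₂ _).comp (f := fun x => (t, x)) (by fun_prop) (fun x hx => ⟨ht, hx⟩)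
    change ∫ x in Icc a₁ b₁ ×ˢ Icc a₂ b₂, fderivWithin ℝ F₂ K (t, x) (0, 0, 1) = 0
    rw [Measure.volume_eq_prod, setIntegral_prod _ hsl]
    refine setIntegral_eq_zero_of_forall_eq_zero fun x hx => ?_
    refine (integral_fderivWithin_segment hK hF₂ h₂.le (φ := fun y => (t, x, y)) (fun y => ?_)
        (fun y hy => ⟨ht, hx, hy⟩)).trans (sub_eq_zero.2 (hp₂ t ht x hx))
    exact (hasDerivAt_const y t).prodMk ((hasDerivAt_const y x).prodMk (hasDerivAt_id y))
  have h01 := (hint hF₀ (1, 0, 0)).add (hint hF₁ (0, 1, 0))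
  refine ⟨(h01.add (hint hF₂ (0, 0, 1))).congr hae.symm, ?_⟩
  rw [integral_congr_ae hae]
  have e1 := integral_add h01 (hint hF₂ (0, 0, 1))
  have e2 := integral_add (hint hF₀ (1, 0, 0)) (hint hF₁ (0, 1, 0))
  simp only [Pi.add_apply] at e1 e2
  rw [e1, e2, i0, i1, i2]
  ring

/-- If the energy density `F₀` vanishes at time `0`, is nonnegative, and has dissipation at least
`G ≥ 0`, then `G` vanishes. -/
theorem eq_zero_of_div_le (hT : 0 < T) (h₁ : a₁ < b₁) (h₂ : a₂ < b₂) {F₀ F₁ F₂ G : ℝ × ℝ × ℝ → ℝ}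
    (hF₀ : ContDiffOn ℝ 1 F₀ (box T a₁ b₁ a₂ b₂)) (hF₁ : ContDiffOn ℝ 1 F₁ (box T a₁ b₁ a₂ b₂))
    (hF₂ : ContDiffOn ℝ 1 F₂ (box T a₁ b₁ a₂ b₂))
    (hp₁ : ∀ t ∈ Icc 0 T, ∀ y ∈ Icc a₂ b₂, F₁ (t, b₁, y) = F₁ (t, a₁, y))
    (hp₂ : ∀ t ∈ Icc 0 T, ∀ x ∈ Icc a₁ b₁, F₂ (t, x, b₂) = F₂ (t, x, a₂))
    (hG : ContinuousOn G (box T a₁ b₁ a₂ b₂)) (hG0 : ∀ q ∈ box T a₁ b₁ a₂ b₂, 0 ≤ G q)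
    (hF0 : ∀ x ∈ Icc a₁ b₁ ×ˢ Icc a₂ b₂, F₀ (0, x) = 0)
    (hFT : ∀ x ∈ Icc a₁ b₁ ×ˢ Icc a₂ b₂, 0 ≤ F₀ (T, x))
    (hle : ∀ q ∈ interior (box T a₁ b₁ a₂ b₂), dT F₀ q + dX F₁ q + dY F₂ q ≤ -G q) :
    ∀ q ∈ box T a₁ b₁ a₂ b₂, G q = 0 := by
  obtain ⟨hi, he⟩ := integral_div_box hT h₁ h₂ hF₀ hF₁ hF₂ hp₁ hp₂ (fun q _ => rfl)
  have hR : MeasurableSet (Icc a₁ b₁ ×ˢ Icc a₂ b₂) := measurableSet_Icc.prod measurableSet_Icc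
  have hGi : IntegrableOn G (box T a₁ b₁ a₂ b₂) := hG.integrableOn_compact isCompact_box
  rw [setIntegral_eq_zero_of_forall_eq_zero hF0, sub_zero] at he
  have h1 : 0 ≤ ∫ x in Icc a₁ b₁ ×ˢ Icc a₂ b₂, F₀ (T, x) := setIntegral_nonneg hR hFT
  have h2 := integral_mono_ae hi hGi.neg (by
    filter_upwards [ae_mem_interior_box] with q hq using hle q hq)
  have h3 : 0 ≤ ∫ q in box T a₁ b₁ a₂ b₂, G q :=
    setIntegral_nonneg isCompact_box.measurableSet hG0
  simp only [Pi.neg_apply, integral_neg] at h2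
  have h4 : ∫ q in box T a₁ b₁ a₂ b₂, G q = 0 := by linarith
  rw [setIntegral_eq_zero_iff_of_nonneg_ae ?_ hGi] at h4
  · refine Measure.eqOn_of_ae_eq (g := fun _ => 0) h4 hG continuousOn_const ?_
    rw [convex_box.closure_interior_eq_closure_of_nonempty_interior
      (interior_box_nonempty hT h₁ h₂)]
    exact subset_closure
  · exact (ae_restrict_iff' isCompact_box.measurableSet).2 (ae_of_all _ hG0)

end Box

/-! ### Flows and their uniqueness -/

/-- The closed space-time domain `[0, ∞) × ℝ × [-π, π]`. -/
def spaceTime : Set (ℝ × ℝ × ℝ) := Ici 0 ×ˢ strip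

theorem interior_spaceTime : interior spaceTime = Ioi 0 ×ˢ (univ ×ˢ Ioo (-π) π) := by
  rw [spaceTime, strip, interior_prod_eq, interior_prod_eq, interior_Ici, interior_Icc,
    interior_univ]

theorem uniqueDiffOn_spaceTime : UniqueDiffOn ℝ spaceTime := by
  refine uniqueDiffOn_convex ((convex_Ici 0).prod (convex_univ.prod (convex_Icc _ _))) ?_
  rw [interior_spaceTime]
  exact ⟨(1, 0, 0), by simp [pi_pos]⟩

theorem box_subset_spaceTime {T a₁ b₁ a₂ b₂ : ℝ} (h₁ : -π ≤ a₂) (h₂ : b₂ ≤ π) :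
    box T a₁ b₁ a₂ b₂ ⊆ spaceTime := by
  rintro ⟨t, a, b⟩ ⟨ht, -, hb⟩
  exact ⟨ht.1, mem_univ _, h₁.trans hb.1, hb.2.trans h₂⟩

/-- A `C¹` solution `(r, (u, v), p)` of the porous media equation in the interior of the strip,
periodic in `x₁`, as functions of `(t, x₁, x₂)`. There is no boundary condition for `x₂ = ±π`. -/
structure IsFlow (r u v p : ℝ × ℝ × ℝ → ℝ) : Prop where
  smooth_r : ContDiffOn ℝ 1 r spaceTime
  smooth_u : ContDiffOn ℝ 1 u spaceTime
  smooth_v : ContDiffOn ℝ 1 v spaceTime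
  smooth_p : ContDiffOn ℝ 1 p spaceTime
  periodic_r : ∀ t, 0 ≤ t → ∀ b ∈ Icc (-π) π, r (t, π, b) = r (t, -π, b)
  periodic_u : ∀ t, 0 ≤ t → ∀ b ∈ Icc (-π) π, u (t, π, b) = u (t, -π, b)
  periodic_v : ∀ t, 0 ≤ t → ∀ b ∈ Icc (-π) π, v (t, π, b) = v (t, -π, b)
  periodic_p : ∀ t, 0 ≤ t → ∀ b ∈ Icc (-π) π, p (t, π, b) = p (t, -π, b)
  transport : ∀ q ∈ interior spaceTime, dT r q + (u q * dX r q + v q * dY r q) = 0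
  div_free : ∀ q ∈ interior spaceTime, dX u q + dY v q = 0
  darcy1 : ∀ q ∈ interior spaceTime, u q + dX p q = 0
  darcy2 : ∀ q ∈ interior spaceTime, v q + dY p q = -r q

theorem hasFDerivAt_of_interior {F : ℝ × ℝ × ℝ → ℝ} (hF : ContDiffOn ℝ 1 F spaceTime)
    {q : ℝ × ℝ × ℝ} (hq : q ∈ interior spaceTime) : HasFDerivAt F (fderiv ℝ F q) q :=
  ((hF.differentiableOn one_ne_zero).differentiableAt
    (mem_interior_iff_mem_nhds.1 hq)).hasFDerivAt

/-- The gradient of a `C¹` function is bounded on compact boxes. -/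
theorem exists_bound_gradient {F : ℝ × ℝ × ℝ → ℝ} (hF : ContDiffOn ℝ 1 F spaceTime)
    (T a₁ b₁ : ℝ) :
    ∃ L, ∀ q ∈ interior (box T a₁ b₁ (-π) π), |dX F q| ≤ L ∧ |dY F q| ≤ L := by
  have hsub : box T a₁ b₁ (-π) π ⊆ spaceTime := box_subset_spaceTime le_rfl le_rfl
  obtain ⟨L, hL⟩ := isCompact_box.exists_bound_of_continuousOn
    ((hF.continuousOn_fderivWithin uniqueDiffOn_spaceTime le_rfl).mono hsub)
  refine ⟨L, fun q hq => ?_⟩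
  have h1 := hL q (interior_subset hq)
  rw [fderivWithin_of_mem_nhds (mem_interior_iff_mem_nhds.1 (interior_mono hsub hq))] at h1
  have key : ∀ e : ℝ × ℝ × ℝ, ‖e‖ = 1 → |fderiv ℝ F q e| ≤ L := fun e he => by
    have := (fderiv ℝ F q).le_opNorm e
    rw [he, mul_one] at this
    exact this.trans h1
  exact ⟨key _ (by simp [Prod.norm_def]), key _ (by simp [Prod.norm_def])⟩

theorem hasFDerivAt_exp_time (K : ℝ) (q : ℝ × ℝ × ℝ) :
    HasFDerivAt (fun q : ℝ × ℝ × ℝ => exp (-(K * q.1)))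
      (exp (-(K * q.1)) • -(K • ContinuousLinearMap.fst ℝ ℝ (ℝ × ℝ))) q :=
  ((hasFDerivAt_fst.const_mul K).neg).exp

/-- The local balance of the relative energy of two flows, weighted with `e^{-Kt}`. The pressure
enters only through a flux, because both velocities are divergence-free. -/
theorem IsFlow.relative_energy_div {r u v p r' u' v' p' : ℝ × ℝ × ℝ → ℝ} (h : IsFlow r u v p)
    (h' : IsFlow r' u' v' p') (K : ℝ) {q : ℝ × ℝ × ℝ} (hq : q ∈ interior spaceTime) :
    dT (fun q => exp (-(K * q.1)) * ((r q - r' q) ^ 2 / 2)) q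
      + dX (fun q => exp (-(K * q.1)) *
          (u q * (r q - r' q) ^ 2 / 2 + (u q - u' q) * (p q - p' q))) q
      + dY (fun q => exp (-(K * q.1)) *
          (v q * (r q - r' q) ^ 2 / 2 + (v q - v' q) * (p q - p' q))) q
      = exp (-(K * q.1)) * (-(K * (r q - r' q) ^ 2 / 2)
        - (r q - r' q) * ((u q - u' q) * dX r' q + (v q - v' q) * dY r' q)
        - (u q - u' q) ^ 2 - (v q - v' q) ^ 2 - (v q - v' q) * (r q - r' q)) := by
  have dE := hasFDerivAt_exp_time K q
  have dr := hasFDerivAt_of_interior h.smooth_r hq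
  have du := hasFDerivAt_of_interior h.smooth_u hq
  have dv := hasFDerivAt_of_interior h.smooth_v hq
  have dp := hasFDerivAt_of_interior h.smooth_p hq
  have dr' := hasFDerivAt_of_interior h'.smooth_r hq
  have du' := hasFDerivAt_of_interior h'.smooth_u hq
  have dv' := hasFDerivAt_of_interior h'.smooth_v hq
  have dp' := hasFDerivAt_of_interior h'.smooth_p hq
  have dw := (dr.sub dr').pow 2
  have e0 := (dE.mul (dw.mul_const (2⁻¹))).fderiv
  have e1 := (dE.mul (((du.mul dw).mul_const (2⁻¹)).add ((du.sub du').mul (dp.sub dp')))).fderiv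
  have e2 := (dE.mul (((dv.mul dw).mul_const (2⁻¹)).add ((dv.sub dv').mul (dp.sub dp')))).fderiv
  have t0 := h.transport q hq
  have t1 := h.div_free q hq
  have t2 := h.darcy1 q hq
  have t3 := h.darcy2 q hq
  have t0' := h'.transport q hq
  have t1' := h'.div_free q hq
  have t2' := h'.darcy1 q hq
  have t3' := h'.darcy2 q hq
  simp only [dT, dX, dY, div_eq_mul_inv] at t0 t1 t2 t3 t0' t1' t2' t3' ⊢
  erw [e0, e1, e2]
  simp
  linear_combination exp (-(K * q.1)) * ((r q - r' q) * (t0 - t0')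
    + ((r q - r' q) ^ 2 / 2 + (p q - p' q)) * t1 - (p q - p' q) * t1'
    + (u q - u' q) * (t2 - t2') + (v q - v' q) * (t3 - t3'))

/-- **Uniqueness.** Two flows with the same initial density agree if the flux of the relative
energy `(r - r')² / 2` and of the relative pressure has no jump between `x₂ = π` and `x₂ = -π`.
The proof is the energy method: the field below has density `e^{-Kt} (r - r')² / 2`, and for large
`K` it dissipates both `(r - r')²` and the square of the velocity difference. -/
theorem IsFlow.unique {r u v p r' u' v' p' : ℝ × ℝ × ℝ → ℝ} (h : IsFlow r u v p)
    (h' : IsFlow r' u' v' p')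
    (hflux : ∀ t, 0 ≤ t → ∀ a,
      v (t, a, π) * (r (t, a, π) - r' (t, a, π)) ^ 2 / 2
        + (v (t, a, π) - v' (t, a, π)) * (p (t, a, π) - p' (t, a, π))
      = v (t, a, -π) * (r (t, a, -π) - r' (t, a, -π)) ^ 2 / 2
        + (v (t, a, -π) - v' (t, a, -π)) * (p (t, a, -π) - p' (t, a, -π)))
    (hinit : ∀ a ∈ Icc (-π) π, ∀ b ∈ Icc (-π) π, r (0, a, b) = r' (0, a, b)) :
    ∀ t, 0 ≤ t → ∀ a ∈ Icc (-π) π, ∀ b ∈ Icc (-π) π,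
      r (t, a, b) = r' (t, a, b) ∧ u (t, a, b) = u' (t, a, b) ∧ v (t, a, b) = v' (t, a, b) := by
  intro t ht a ha b hb
  obtain ⟨L, hL⟩ := exists_bound_gradient h'.smooth_r (t + 1) (-π) π
  have hT : 0 < t + 1 := by linarith
  have hππ : -π < π := by linarith [pi_pos]
  set B := box (t + 1) (-π) π (-π) π with hB
  have hsub : B ⊆ spaceTime := box_subset_spaceTime le_rfl le_rfl
  -- large enough to absorb the cross terms, by completing squares in the velocity difference
  set K : ℝ := 4 * L ^ 2 + 3 with hK
  have hE : ContDiffOn ℝ 1 (fun q : ℝ × ℝ × ℝ => exp (-(K * q.1))) B := by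
    apply ContDiff.contDiffOn; fun_prop
  have hr := h.smooth_r.mono hsub
  have hu := h.smooth_u.mono hsub
  have hv := h.smooth_v.mono hsub
  have hp := h.smooth_p.mono hsub
  have hr' := h'.smooth_r.mono hsub
  have hu' := h'.smooth_u.mono hsub
  have hv' := h'.smooth_v.mono hsub
  have hp' := h'.smooth_p.mono hsub
  have hw := (hr.sub hr').pow 2
  have key := eq_zero_of_div_le hT hππ hππ
    (F₀ := fun q => exp (-(K * q.1)) * ((r q - r' q) ^ 2 / 2))
    (F₁ := fun q => exp (-(K * q.1)) *
      (u q * (r q - r' q) ^ 2 / 2 + (u q - u' q) * (p q - p' q)))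
    (F₂ := fun q => exp (-(K * q.1)) *
      (v q * (r q - r' q) ^ 2 / 2 + (v q - v' q) * (p q - p' q)))
    (G := fun q => exp (-(K * q.1)) *
      (((r q - r' q) ^ 2 + (u q - u' q) ^ 2 + (v q - v' q) ^ 2) / 4))
    (hE.mul (hw.div_const 2))
    (hE.mul (((hu.mul hw).div_const 2).add ((hu.sub hu').mul (hp.sub hp'))))
    (hE.mul (((hv.mul hw).div_const 2).add ((hv.sub hv').mul (hp.sub hp'))))
    (fun τ hτ y hy => by
      simp only [h.periodic_r τ hτ.1 y hy, h.periodic_u τ hτ.1 y hy, h.periodic_p τ hτ.1 y hy,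
        h'.periodic_r τ hτ.1 y hy, h'.periodic_u τ hτ.1 y hy, h'.periodic_p τ hτ.1 y hy])
    (fun τ hτ x hx => by simp only [hflux τ hτ.1 x])
    (hE.mul ((hw.add ((hu.sub hu').pow 2)).add ((hv.sub hv').pow 2) |>.div_const 4)).continuousOn
    (fun q _ => by positivity)
    (fun x hx => by simp [hinit x.1 hx.1 x.2 hx.2])
    (fun x hx => by positivity)
    (fun q hq => by
      have hqi : q ∈ interior spaceTime := interior_mono hsub hq
      obtain ⟨l1, l2⟩ := hL q hq
      rw [h.relative_energy_div h' K hqi, neg_mul_eq_mul_neg (exp (-(K * q.1)))]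
      refine mul_le_mul_of_nonneg_left ?_ (exp_pos _).le
      set w := r q - r' q
      set x := u q - u' q
      set y := v q - v' q
      set A := dX r' q
      set D := dY r' q
      have hA : A ^ 2 ≤ L ^ 2 := sq_le_sq' (abs_le.1 l1).1 (abs_le.1 l1).2
      have hD : D ^ 2 ≤ L ^ 2 := sq_le_sq' (abs_le.1 l2).1 (abs_le.1 l2).2
      have hA' := mul_le_mul_of_nonneg_right hA (sq_nonneg w)
      have hD' := mul_le_mul_of_nonneg_right hD (sq_nonneg w)
      have s1 := sq_nonneg (x / 2 + w * A)
      have s2 := sq_nonneg (y / 2 + w * D)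
      have s3 := sq_nonneg (y / 2 + w)
      rw [hK]
      nlinarith [sq_nonneg x, sq_nonneg y, sq_nonneg w])
  have := key (t, a, b) ⟨⟨ht, by linarith⟩, ha, hb⟩
  have h3 : (r (t, a, b) - r' (t, a, b)) ^ 2 + (u (t, a, b) - u' (t, a, b)) ^ 2
      + (v (t, a, b) - v' (t, a, b)) ^ 2 = 0 := by
    have h4 := (mul_eq_zero.1 this).resolve_left (exp_pos _).ne'
    linarith
  have s1 := sq_nonneg (r (t, a, b) - r' (t, a, b))
  have s2 := sq_nonneg (u (t, a, b) - u' (t, a, b))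
  have s3 := sq_nonneg (v (t, a, b) - v' (t, a, b))
  refine ⟨?_, ?_, ?_⟩ <;> refine sub_eq_zero.1 (pow_eq_zero_iff two_ne_zero |>.1 ?_) <;> linarith

/-! ### Reflections -/

/-- The reflection `(t, x₁, x₂) ↦ (t, σ x₁, τ x₂)`. -/
noncomputable def reflection (σ τ : ℝ) : ℝ × ℝ × ℝ →L[ℝ] ℝ × ℝ × ℝ :=
  (ContinuousLinearMap.fst ℝ ℝ (ℝ × ℝ)).prod
    ((σ • (ContinuousLinearMap.fst ℝ ℝ ℝ).comp (ContinuousLinearMap.snd ℝ ℝ (ℝ × ℝ))).prod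
      (τ • (ContinuousLinearMap.snd ℝ ℝ ℝ).comp (ContinuousLinearMap.snd ℝ ℝ (ℝ × ℝ))))

@[simp]
theorem reflection_apply (σ τ t a b : ℝ) : reflection σ τ (t, a, b) = (t, σ * a, τ * b) := rfl

theorem neg_or_self_mem_Icc {τ b c : ℝ} (hτ : τ = 1 ∨ τ = -1) (hb : b ∈ Icc (-c) c) :
    τ * b ∈ Icc (-c) c := by
  rcases hτ with rfl | rfl
  · simpa using hb
  · exact ⟨by linarith [hb.2], by linarith [hb.1]⟩

theorem mapsTo_reflection {σ τ : ℝ} (hτ : τ = 1 ∨ τ = -1) :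
    MapsTo (reflection σ τ) spaceTime spaceTime := by
  rintro ⟨t, a, b⟩ ⟨ht, -, hb⟩
  exact ⟨ht, mem_univ _, neg_or_self_mem_Icc hτ hb⟩

theorem mapsTo_reflection_interior {σ τ : ℝ} (hτ : τ = 1 ∨ τ = -1) :
    MapsTo (reflection σ τ) (interior spaceTime) (interior spaceTime) := by
  rw [interior_spaceTime]
  rintro ⟨t, a, b⟩ ⟨ht, -, hb⟩
  refine ⟨ht, mem_univ _, ?_⟩
  rcases hτ with rfl | rfl
  · simpa using hb
  · exact ⟨by simpa using hb.2, by simpa using neg_lt.1 hb.1⟩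

theorem fderiv_reflection {F : ℝ × ℝ × ℝ → ℝ} (hF : ContDiffOn ℝ 1 F spaceTime) {σ τ : ℝ}
    (hτ : τ = 1 ∨ τ = -1) (c : ℝ) {q : ℝ × ℝ × ℝ} (hq : q ∈ interior spaceTime) :
    dT (fun q => c * F (reflection σ τ q)) q = c * dT F (reflection σ τ q) ∧
    dX (fun q => c * F (reflection σ τ q)) q = c * (σ * dX F (reflection σ τ q)) ∧
    dY (fun q => c * F (reflection σ τ q)) q = c * (τ * dY F (reflection σ τ q)) := by
  have h1 := ((hasFDerivAt_of_interior hF (mapsTo_reflection_interior (σ := σ) hτ hq)).comp q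
    (reflection σ τ).hasFDerivAt).const_mul c
  have e0 : reflection σ τ (1, 0, 0) = (1, 0, 0) := by simp
  have e1 : reflection σ τ (0, 1, 0) = σ • (0, 1, 0) := by simp
  have e2 : reflection σ τ (0, 0, 1) = τ • (0, 0, 1) := by simp
  have h2 := h1.fderiv
  simp only [Function.comp_def] at h2
  refine ⟨?_, ?_, ?_⟩
  · simp only [dT, h2, smul_eq_mul, smul_apply,
      ContinuousLinearMap.comp_apply, e0]
  · simp only [dX, h2, smul_eq_mul, smul_apply,
      ContinuousLinearMap.comp_apply, e1, map_smul]
  · simp only [dY, h2, smul_eq_mul, smul_apply,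
      ContinuousLinearMap.comp_apply, e2, map_smul]

/-- The equation is invariant under both reflections, if `r` and `v` change sign with `x₂`, and
`u` changes sign with `x₁`. -/
theorem IsFlow.reflect {r u v p : ℝ × ℝ × ℝ → ℝ} (h : IsFlow r u v p) {σ τ : ℝ}
    (hσ : σ = 1 ∨ σ = -1) (hτ : τ = 1 ∨ τ = -1) :
    IsFlow (fun q => τ * r (reflection σ τ q)) (fun q => σ * u (reflection σ τ q))
      (fun q => τ * v (reflection σ τ q)) (fun q => 1 * p (reflection σ τ q)) := by
  have hsm : ∀ {F : ℝ × ℝ × ℝ → ℝ} (c : ℝ), ContDiffOn ℝ 1 F spaceTime →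
      ContDiffOn ℝ 1 (fun q => c * F (reflection σ τ q)) spaceTime := fun c hF =>
    contDiffOn_const.mul (hF.comp (reflection σ τ).contDiff.contDiffOn (mapsTo_reflection hτ))
  have hper : ∀ {F : ℝ × ℝ × ℝ → ℝ} (c : ℝ),
      (∀ t, 0 ≤ t → ∀ b ∈ Icc (-π) π, F (t, π, b) = F (t, -π, b)) →
      ∀ t, 0 ≤ t → ∀ b ∈ Icc (-π) π,
        c * F (reflection σ τ (t, π, b)) = c * F (reflection σ τ (t, -π, b)) := by
    intro F c hF t ht b hb
    have := hF t ht (τ * b) (neg_or_self_mem_Icc hτ hb)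
    rcases hσ with rfl | rfl
    · simp [this]
    · simp [this]
  have hσ2 : σ * σ = 1 := by rcases hσ with rfl | rfl <;> norm_num
  have hτ2 : τ * τ = 1 := by rcases hτ with rfl | rfl <;> norm_num
  refine ⟨hsm _ h.smooth_r, hsm _ h.smooth_u, hsm _ h.smooth_v, hsm _ h.smooth_p,
    hper _ h.periodic_r, hper _ h.periodic_u, hper _ h.periodic_v, hper _ h.periodic_p,
    fun q hq => ?_, fun q hq => ?_, fun q hq => ?_, fun q hq => ?_⟩
  · obtain ⟨e0, e1, e2⟩ := fderiv_reflection h.smooth_r (σ := σ) hτ τ hq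
    rw [e0, e1, e2]
    linear_combination τ * h.transport _ (mapsTo_reflection_interior (σ := σ) hτ hq)
      + u (reflection σ τ q) * τ * dX r (reflection σ τ q) * hσ2
      + v (reflection σ τ q) * τ * dY r (reflection σ τ q) * hτ2
  · obtain ⟨-, e1, -⟩ := fderiv_reflection h.smooth_u (σ := σ) hτ σ hq
    obtain ⟨-, -, e2⟩ := fderiv_reflection h.smooth_v (σ := σ) hτ τ hq
    rw [e1, e2]
    linear_combination h.div_free _ (mapsTo_reflection_interior (σ := σ) hτ hq)
      + dX u (reflection σ τ q) * hσ2 + dY v (reflection σ τ q) * hτ2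
  · obtain ⟨-, e1, -⟩ := fderiv_reflection h.smooth_p (σ := σ) hτ 1 hq
    rw [e1]
    linear_combination σ * h.darcy1 _ (mapsTo_reflection_interior (σ := σ) hτ hq)
  · obtain ⟨-, -, e2⟩ := fderiv_reflection h.smooth_p (σ := σ) hτ 1 hq
    rw [e2]
    linear_combination τ * h.darcy2 _ (mapsTo_reflection_interior (σ := σ) hτ hq)

/-- The boundary conditions for `x₂ = ±π`: either there is no flow through the boundary, or
everything is `2π`-periodic in `x₂`. -/
def VerticalBC (r v p : ℝ × ℝ × ℝ → ℝ) : Prop :=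
  (∀ t, 0 ≤ t → ∀ a, v (t, a, π) = 0 ∧ v (t, a, -π) = 0) ∨
  (∀ t, 0 ≤ t → ∀ a, r (t, a, π) = r (t, a, -π) ∧ v (t, a, π) = v (t, a, -π) ∧
    p (t, a, π) = p (t, a, -π))

/-- Flows inherit the reflection symmetries of their initial density, by uniqueness. -/
theorem IsFlow.symmetric {r u v p : ℝ × ℝ × ℝ → ℝ} (h : IsFlow r u v p)
    (hbc : VerticalBC r v p) {σ τ : ℝ} (hσ : σ = 1 ∨ σ = -1) (hτ : τ = 1 ∨ τ = -1)
    (hinit : ∀ a ∈ Icc (-π) π, ∀ b ∈ Icc (-π) π, r (0, a, b) = τ * r (0, σ * a, τ * b)) :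
    ∀ t, 0 ≤ t → ∀ a ∈ Icc (-π) π, ∀ b ∈ Icc (-π) π,
      r (t, a, b) = τ * r (t, σ * a, τ * b) ∧ u (t, a, b) = σ * u (t, σ * a, τ * b) ∧
        v (t, a, b) = τ * v (t, σ * a, τ * b) := by
  refine h.unique (h.reflect hσ hτ) (fun t ht a => ?_) hinit
  simp only [reflection_apply]
  rcases hbc with hbc | hbc
  · obtain ⟨h1, h2⟩ := hbc t ht a
    obtain ⟨h3, h4⟩ := hbc t ht (σ * a)
    rcases hτ with rfl | rfl <;> simp [h1, h2, h3, h4]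
  · obtain ⟨h1, h2, h3⟩ := hbc t ht a
    obtain ⟨h4, h5, h6⟩ := hbc t ht (σ * a)
    rcases hτ with rfl | rfl <;> simp [h1, h2, h3, h4, h5, h6]

/-! ### Solutions on the torus and on the strip as flows -/

theorem deriv_eq_fderiv {F : ℝ × ℝ × ℝ → ℝ} {t a b : ℝ} (h : DifferentiableAt ℝ F (t, a, b)) :
    deriv (fun s => F (s, a, b)) t = dT F (t, a, b) ∧
    deriv (fun s => F (t, s, b)) a = dX F (t, a, b) ∧
    deriv (fun s => F (t, a, s)) b = dY F (t, a, b) := by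
  refine ⟨?_, ?_, ?_⟩
  · exact (h.hasFDerivAt.comp_hasDerivAt t
      ((hasDerivAt_id t).prodMk (hasDerivAt_const t (a, b)))).deriv
  · exact (h.hasFDerivAt.comp_hasDerivAt (f := fun s => (t, s, b)) a
      ((hasDerivAt_const a t).prodMk ((hasDerivAt_id a).prodMk (hasDerivAt_const a b)))).deriv
  · exact (h.hasFDerivAt.comp_hasDerivAt (f := fun s => (t, a, s)) b
      ((hasDerivAt_const b t).prodMk ((hasDerivAt_const b a).prodMk (hasDerivAt_id b)))).deriv

/-- Smooth solutions in the interior of the strip are flows, whatever their boundary condition; this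
covers the restrictions of torus solutions. -/
theorem isFlow_of_strip {ρ : ℝ → ℝ × ℝ → ℝ} {u : ℝ → ℝ × ℝ → ℝ × ℝ} {p : ℝ → ℝ × ℝ → ℝ}
    (hρ : ContDiffOn ℝ ∞ (fun q : ℝ × (ℝ × ℝ) => ρ q.1 q.2) (Ici 0 ×ˢ strip))
    (hu : ContDiffOn ℝ ∞ (fun q : ℝ × (ℝ × ℝ) => u q.1 q.2) (Ici 0 ×ˢ strip))
    (hp : ContDiffOn ℝ ∞ (fun q : ℝ × (ℝ × ℝ) => p q.1 q.2) (Ici 0 ×ˢ strip))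
    (pρ : ∀ t, 0 ≤ t → StripPeriodic (ρ t)) (pu : ∀ t, 0 ≤ t → StripPeriodic (u t))
    (pp : ∀ t, 0 ≤ t → StripPeriodic (p t))
    (transport : ∀ t, 0 ≤ t → ∀ x ∈ interior strip,
      timeDeriv ρ t x + ((u t x).1 * partial1 (ρ t) x + (u t x).2 * partial2 (ρ t) x) = 0)
    (div_free : ∀ t, 0 ≤ t → ∀ x ∈ interior strip,
      partial1 (fun y => (u t y).1) x + partial2 (fun y => (u t y).2) x = 0)
    (darcy1 : ∀ t, 0 ≤ t → ∀ x ∈ interior strip, (u t x).1 + partial1 (p t) x = 0)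
    (darcy2 : ∀ t, 0 ≤ t → ∀ x ∈ interior strip, (u t x).2 + partial2 (p t) x = -ρ t x) :
    IsFlow (fun q => ρ q.1 q.2) (fun q => (u q.1 q.2).1) (fun q => (u q.1 q.2).2)
      (fun q => p q.1 q.2) := by
  have sρ : ContDiffOn ℝ 1 (fun q : ℝ × (ℝ × ℝ) => ρ q.1 q.2) spaceTime := hρ.of_le (by simp)
  have su : ContDiffOn ℝ 1 (fun q : ℝ × (ℝ × ℝ) => u q.1 q.2) spaceTime := hu.of_le (by simp)
  have su1 : ContDiffOn ℝ 1 (fun q : ℝ × (ℝ × ℝ) => (u q.1 q.2).1) spaceTime := su.fst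
  have su2 : ContDiffOn ℝ 1 (fun q : ℝ × (ℝ × ℝ) => (u q.1 q.2).2) spaceTime := su.snd
  have sp : ContDiffOn ℝ 1 (fun q : ℝ × (ℝ × ℝ) => p q.1 q.2) spaceTime := hp.of_le (by simp)
  have hper : ∀ {E : Type} {f : ℝ → ℝ × ℝ → E}, (∀ t, 0 ≤ t → StripPeriodic (f t)) →
      ∀ t, 0 ≤ t → ∀ b ∈ Icc (-π) π, f t (π, b) = f t (-π, b) := fun hf t ht b hb => by
    have := hf t ht (-π) b hb
    rwa [show -π + 2 * π = π by ring] at this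
  have hint : ∀ {t a b : ℝ}, (t, a, b) ∈ interior spaceTime →
      0 < t ∧ (a, b) ∈ interior strip := by
    intro t a b h
    rw [interior_spaceTime] at h
    refine ⟨h.1, ?_⟩
    rw [strip, interior_prod_eq, interior_univ, interior_Icc]
    exact h.2
  refine ⟨sρ, su1, su2, sp, hper pρ, fun t ht b hb => congrArg Prod.fst (hper pu t ht b hb),
    fun t ht b hb => congrArg Prod.snd (hper pu t ht b hb), hper pp, ?_, ?_, ?_, ?_⟩
  · rintro ⟨t, a, b⟩ hq
    obtain ⟨ht, hx⟩ := hint hq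
    obtain ⟨e0, e1, e2⟩ := deriv_eq_fderiv (hasFDerivAt_of_interior sρ hq).differentiableAt
    rw [← e0, ← e1, ← e2]
    have := transport t ht.le _ hx
    rwa [timeDeriv, derivWithin_of_mem_nhds (Ici_mem_nhds ht)] at this
  · rintro ⟨t, a, b⟩ hq
    obtain ⟨ht, hx⟩ := hint hq
    obtain ⟨-, e1, -⟩ := deriv_eq_fderiv (hasFDerivAt_of_interior su1 hq).differentiableAt
    obtain ⟨-, -, e2⟩ := deriv_eq_fderiv (hasFDerivAt_of_interior su2 hq).differentiableAt
    rw [← e1, ← e2]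
    exact div_free t ht.le _ hx
  · rintro ⟨t, a, b⟩ hq
    obtain ⟨ht, hx⟩ := hint hq
    obtain ⟨-, e1, -⟩ := deriv_eq_fderiv (hasFDerivAt_of_interior sp hq).differentiableAt
    rw [← e1]
    exact darcy1 t ht.le _ hx
  · rintro ⟨t, a, b⟩ hq
    obtain ⟨ht, hx⟩ := hint hq
    obtain ⟨-, -, e2⟩ := deriv_eq_fderiv (hasFDerivAt_of_interior sp hq).differentiableAt
    rw [← e2]
    exact darcy2 t ht.le _ hx

theorem IsStripSolution.isFlow {ρ : ℝ → ℝ × ℝ → ℝ} {u : ℝ → ℝ × ℝ → ℝ × ℝ} {p : ℝ → ℝ × ℝ → ℝ}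
    (h : IsStripSolution ρ u p) :
    IsFlow (fun q => ρ q.1 q.2) (fun q => (u q.1 q.2).1) (fun q => (u q.1 q.2).2)
      (fun q => p q.1 q.2) :=
  isFlow_of_strip h.smooth_ρ h.smooth_u h.smooth_p h.periodic_ρ h.periodic_u h.periodic_p
    h.transport h.div_free h.darcy1 h.darcy2

theorem Periodic1.stripPeriodic {E : Type*} {f : ℝ × ℝ → E} (h : Periodic1 f) :
    StripPeriodic f := fun a b _ => h a b

/-- Symmetric solutions on the torus solve the equation on the strip: by uniqueness the second
velocity component is odd in `x₂`, and being `2π`-periodic it vanishes for `x₂ = ±π`. -/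
theorem IsTorusSolution.isStripSolution {ρ₀ : ℝ × ℝ → ℝ} (h₀ : IsTorusData ρ₀)
    {ρ : ℝ → ℝ × ℝ → ℝ} {u : ℝ → ℝ × ℝ → ℝ × ℝ} {p : ℝ → ℝ × ℝ → ℝ}
    (h : IsTorusSolution ρ u p) (hinit : ρ 0 = ρ₀) : IsStripSolution ρ u p := by
  have hsub : Ici (0 : ℝ) ×ˢ strip ⊆ Ici 0 ×ˢ univ := prod_mono_right (subset_univ _)
  have hf := isFlow_of_strip (h.smooth_ρ.mono hsub) (h.smooth_u.mono hsub) (h.smooth_p.mono hsub)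
    (fun t ht => (h.periodic_ρ t ht).1.stripPeriodic)
    (fun t ht => (h.periodic_u t ht).1.stripPeriodic)
    (fun t ht => (h.periodic_p t ht).1.stripPeriodic)
    (fun t ht x _ => h.transport t ht x) (fun t ht x _ => h.div_free t ht x)
    (fun t ht x _ => h.darcy1 t ht x) (fun t ht x _ => h.darcy2 t ht x)
  have hper : ∀ {E : Type} {f : ℝ × ℝ → E}, Periodic2 f → ∀ a, f (a, π) = f (a, -π) := by
    intro E f hf a
    have := hf a (-π)
    rwa [show -π + 2 * π = π by ring] at this
  have hbc : VerticalBC (fun q => ρ q.1 q.2) (fun q => (u q.1 q.2).2) (fun q => p q.1 q.2) :=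
    Or.inr fun t ht a => ⟨hper (h.periodic_ρ t ht).2 a,
      congrArg Prod.snd (hper (h.periodic_u t ht).2 a), hper (h.periodic_p t ht).2 a⟩
  have hodd := hf.symmetric hbc (σ := 1) (τ := -1) (Or.inl rfl) (Or.inr rfl)
    (fun a _ b _ => by simp [hinit, h₀.odd2])
  have hzero : ∀ t, 0 ≤ t → ∀ a, (u t (a, π)).2 = 0 := by
    intro t ht a
    have hp1 : Function.Periodic (fun a => (u t (a, π)).2) (2 * π) := fun a =>
      congrArg Prod.snd ((h.periodic_u t ht).1 a π)
    obtain ⟨a', ha', he⟩ := hp1.exists_mem_Ico two_pi_pos a (-π)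
    have h1 := (hodd t ht a' ⟨ha'.1, by linarith [ha'.2]⟩ π ⟨by linarith [pi_pos], le_rfl⟩).2.2
    have h2 := congrArg Prod.snd (hper (h.periodic_u t ht).2 a')
    simp only [one_mul, neg_mul] at h1
    refine he.trans ?_
    linarith
  exact ⟨h.smooth_ρ.mono hsub, h.smooth_u.mono hsub, h.smooth_p.mono hsub,
    fun t ht => (h.periodic_ρ t ht).1.stripPeriodic,
    fun t ht => (h.periodic_u t ht).1.stripPeriodic,
    fun t ht => (h.periodic_p t ht).1.stripPeriodic,
    fun t ht x _ => h.transport t ht x, fun t ht x _ => h.div_free t ht x,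
    fun t ht x _ => h.darcy1 t ht x, fun t ht x _ => h.darcy2 t ht x,
    fun t ht a => ⟨hzero t ht a,
      (congrArg Prod.snd (hper (h.periodic_u t ht).2 a)).symm.trans (hzero t ht a)⟩⟩

theorem IsTorusData.isStripData {ρ₀ : ℝ × ℝ → ℝ} (h : IsTorusData ρ₀) : IsStripData ρ₀ := by
  refine ⟨h.smooth.contDiffOn, h.periodic.1.stripPeriodic, ?_, fun a b _ => h.odd2 a b,
    fun a b _ => h.even1 a b, fun b _ => h.zero_axis b, h.nonneg⟩
  obtain ⟨⟨a, b⟩, hx⟩ := h.nonzero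
  have hp : Function.Periodic (fun b => ρ₀ (a, b)) (2 * π) := fun b => h.periodic.2 a b
  obtain ⟨b', hb', he⟩ := hp.exists_mem_Ico two_pi_pos b (-π)
  exact ⟨(a, b'), ⟨mem_univ _, hb'.1, by linarith [hb'.2]⟩, fun h0 =>
    hx (he.trans h0)⟩

/-! ### Conserved quantities, positivity and dissipation -/

/-- The fundamental domain `[-π, π]²` of the strip. -/
def cell : Set (ℝ × ℝ) := Icc (-π) π ×ˢ Icc (-π) π

/-- The quadrant `[0, π]²`, which the flow leaves invariant. -/
def quadrant : Set (ℝ × ℝ) := Icc 0 π ×ˢ Icc 0 π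

theorem isCompact_cell : IsCompact cell := isCompact_Icc.prod isCompact_Icc

theorem isCompact_quadrant : IsCompact quadrant := isCompact_Icc.prod isCompact_Icc

theorem quadrant_subset_cell : quadrant ⊆ cell :=
  prod_mono (Icc_subset_Icc_left (by linarith [pi_pos])) (Icc_subset_Icc_left (by linarith [pi_pos]))

theorem cell_subset_strip : cell ⊆ strip := prod_mono_left (subset_univ _)

theorem quadrant_subset_closure_interior : quadrant ⊆ closure (interior quadrant) := by
  have hc : Convex ℝ quadrant := (convex_Icc _ _).prod (convex_Icc _ _)
  rw [hc.closure_interior_eq_closure_of_nonempty_interior]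
  · exact subset_closure
  · rw [quadrant, interior_prod_eq, interior_Icc]
    exact (nonempty_Ioo.2 pi_pos).prod (nonempty_Ioo.2 pi_pos)

theorem continuousOn_slice {F : ℝ × ℝ × ℝ → ℝ} (hF : ContDiffOn ℝ 1 F spaceTime) {t : ℝ}
    (ht : 0 ≤ t) : ContinuousOn (fun x => F (t, x)) strip :=
  hF.continuousOn.comp (by fun_prop) fun _ hx => ⟨ht, hx⟩

/-- A flow in the strip without flow through the boundary, whose density starts from the
data `ρ₀`. -/
structure IsFlowFrom (ρ₀ : ℝ × ℝ → ℝ) (r u v p : ℝ × ℝ × ℝ → ℝ) : Prop extends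
    IsFlow r u v p where
  no_flow : ∀ t, 0 ≤ t → ∀ a, v (t, a, π) = 0 ∧ v (t, a, -π) = 0
  periodic : ∀ t, 0 ≤ t → StripPeriodic fun x => r (t, x)
  init : ∀ x ∈ strip, r (0, x) = ρ₀ x

section

variable {ρ₀ : ℝ × ℝ → ℝ} {r u v p : ℝ × ℝ × ℝ → ℝ}

theorem IsFlowFrom.odd (h : IsFlowFrom ρ₀ r u v p) (h₀ : IsStripData ρ₀) {t a b : ℝ} (ht : 0 ≤ t)
    (ha : a ∈ Icc (-π) π) (hb : b ∈ Icc (-π) π) :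
    r (t, a, -b) = -r (t, a, b) ∧ v (t, a, -b) = -v (t, a, b) := by
  have := h.toIsFlow.symmetric (Or.inl h.no_flow) (σ := 1) (τ := -1) (Or.inl rfl) (Or.inr rfl)
    (fun a _ b hb => by
      have hb' : -b ∈ Icc (-π) π := ⟨by linarith [hb.2], by linarith [hb.1]⟩
      rw [h.init _ ⟨mem_univ _, hb⟩, one_mul, neg_one_mul, neg_one_mul,
        h.init _ ⟨mem_univ _, hb'⟩, h₀.odd2 _ _ hb, neg_neg]) t ht a ha b hb
  simp only [one_mul, neg_one_mul] at this
  constructor <;> linarith [this.1, this.2.2]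

theorem IsFlowFrom.even (h : IsFlowFrom ρ₀ r u v p) (h₀ : IsStripData ρ₀) {t a b : ℝ} (ht : 0 ≤ t)
    (ha : a ∈ Icc (-π) π) (hb : b ∈ Icc (-π) π) :
    r (t, -a, b) = r (t, a, b) ∧ u (t, -a, b) = -u (t, a, b) := by
  have := h.toIsFlow.symmetric (Or.inl h.no_flow) (σ := -1) (τ := 1) (Or.inr rfl) (Or.inl rfl)
    (fun a _ b hb => by
      rw [h.init _ ⟨mem_univ _, hb⟩, one_mul, neg_one_mul, one_mul,
        h.init _ ⟨mem_univ _, hb⟩, h₀.even1 _ _ hb]) t ht a ha b hb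
  simp only [one_mul, neg_one_mul] at this
  constructor <;> linarith [this.1, this.2.1]

/-- By symmetry there is no flow across `x₁ = 0` and `x₁ = π`. -/
theorem IsFlowFrom.u_eq_zero (h : IsFlowFrom ρ₀ r u v p) (h₀ : IsStripData ρ₀) {t b : ℝ}
    (ht : 0 ≤ t) (hb : b ∈ Icc (-π) π) : u (t, 0, b) = 0 ∧ u (t, π, b) = 0 := by
  have hπ := pi_pos
  have h1 := (h.even h₀ ht (a := 0) ⟨by linarith, by linarith⟩ hb).2
  have h2 := (h.even h₀ ht (a := π) ⟨by linarith, le_rfl⟩ hb).2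
  have h3 := h.periodic_u t ht b hb
  rw [neg_zero] at h1
  constructor <;> linarith

/-- By symmetry there is no flow across `x₂ = 0`. -/
theorem IsFlowFrom.v_eq_zero (h : IsFlowFrom ρ₀ r u v p) (h₀ : IsStripData ρ₀) {t a : ℝ}
    (ht : 0 ≤ t) (ha : a ∈ Icc (-π) π) : v (t, a, 0) = 0 := by
  have h1 := (h.odd h₀ ht ha (b := 0) ⟨by linarith [pi_pos], pi_pos.le⟩).2
  rw [neg_zero] at h1
  linarith

/-- The integral over the quadrant of any function of the density is conserved. -/
theorem IsFlowFrom.integral_quadrant_comp (h : IsFlowFrom ρ₀ r u v p) (h₀ : IsStripData ρ₀)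
    {φ : ℝ → ℝ} (hφ : ContDiff ℝ 1 φ) {T : ℝ} (hT : 0 ≤ T) :
    ∫ x in quadrant, φ (r (T, x)) = ∫ x in quadrant, φ (ρ₀ x) := by
  have h0 : ∫ x in quadrant, φ (ρ₀ x) = ∫ x in quadrant, φ (r (0, x)) :=
    setIntegral_congr_fun isCompact_quadrant.measurableSet fun x hx => by
      simp only [h.init x (cell_subset_strip (quadrant_subset_cell hx))]
  rw [h0]
  rcases hT.eq_or_lt with rfl | hT
  · rfl
  have hsub : box T 0 π 0 π ⊆ spaceTime := box_subset_spaceTime (by linarith [pi_pos]) le_rfl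
  have sr : ContDiffOn ℝ 1 (fun q => φ (r q)) (box T 0 π 0 π) :=
    hφ.comp_contDiffOn (h.smooth_r.mono hsub)
  have key := (integral_div_box hT pi_pos pi_pos (F₀ := fun q => φ (r q))
    (F₁ := fun q => u q * φ (r q)) (F₂ := fun q => v q * φ (r q)) (g := fun _ => 0) sr
    ((h.smooth_u.mono hsub).mul sr) ((h.smooth_v.mono hsub).mul sr)
    (fun t ht y hy => by
      have hy' : y ∈ Icc (-π) π := ⟨by linarith [pi_pos, hy.1], hy.2⟩
      rw [(h.u_eq_zero h₀ ht.1 hy').1, (h.u_eq_zero h₀ ht.1 hy').2, zero_mul, zero_mul])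
    (fun t ht x hx => by
      have hx' : x ∈ Icc (-π) π := ⟨by linarith [pi_pos, hx.1], hx.2⟩
      rw [h.v_eq_zero h₀ ht.1 hx', (h.no_flow t ht.1 x).1, zero_mul, zero_mul])
    (fun q hq => by
      have hqi := interior_mono hsub hq
      have dr := ((hφ.differentiable one_ne_zero (r q)).hasDerivAt).comp_hasFDerivAt q
        (hasFDerivAt_of_interior h.smooth_r hqi)
      have e0 := dr.fderiv
      have e1 := ((hasFDerivAt_of_interior h.smooth_u hqi).mul dr).fderiv
      have e2 := ((hasFDerivAt_of_interior h.smooth_v hqi).mul dr).fderiv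
      have t0 := h.transport q hqi
      have t1 := h.div_free q hqi
      simp only [dT, dX, dY] at t0 t1 ⊢
      erw [e0, e1, e2]
      simp
      linear_combination (deriv φ (r q)) * t0 + φ (r q) * t1)).2
  rw [integral_zero] at key
  exact (sub_eq_zero.1 key.symm)

/-- A nonnegative function of the density that vanishes on the quadrant at time `0` vanishes there at
all times. -/
theorem IsFlowFrom.comp_eq_zero (h : IsFlowFrom ρ₀ r u v p) (h₀ : IsStripData ρ₀)
    {φ : ℝ → ℝ} (hφ : ContDiff ℝ 1 φ) (hφ0 : ∀ z, 0 ≤ φ z) (hzero : ∀ x ∈ quadrant, φ (ρ₀ x) = 0)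
    {T : ℝ} (hT : 0 ≤ T) : ∀ x ∈ quadrant, φ (r (T, x)) = 0 := by
  have hc : ContinuousOn (fun x => φ (r (T, x))) quadrant :=
    hφ.continuous.comp_continuousOn ((continuousOn_slice h.smooth_r hT).mono
      (quadrant_subset_cell.trans cell_subset_strip))
  have h1 := h.integral_quadrant_comp h₀ hφ hT
  rw [setIntegral_eq_zero_of_forall_eq_zero hzero,
    setIntegral_eq_zero_iff_of_nonneg_ae (ae_of_all _ fun x => hφ0 _)
      (hc.integrableOn_compact isCompact_quadrant)] at h1
  exact Measure.eqOn_of_ae_eq (g := fun _ => 0) h1 hc continuousOn_const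
    quadrant_subset_closure_interior

/-- The density stays nonnegative in the quadrant. -/
theorem IsFlowFrom.nonneg (h : IsFlowFrom ρ₀ r u v p) (h₀ : IsStripData ρ₀) {t : ℝ} (ht : 0 ≤ t)
    {x : ℝ × ℝ} (hx : x ∈ quadrant) : 0 ≤ r (t, x) := by
  -- `φ` is smooth and nonnegative, and vanishes exactly for `z ≥ 0`
  have := h.comp_eq_zero h₀ (φ := fun z => expNegInvGlue (-z))
    (expNegInvGlue.contDiff.comp contDiff_neg) (fun z => expNegInvGlue.nonneg _)
    (fun x hx => expNegInvGlue.zero_of_nonpos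
      (by simpa using h₀.nonneg x.1 hx.1 x.2 hx.2)) ht x hx
  simpa using this

/-- Upper bounds for the density in the quadrant persist. -/
theorem IsFlowFrom.le (h : IsFlowFrom ρ₀ r u v p) (h₀ : IsStripData ρ₀) {M : ℝ}
    (hM : ∀ x ∈ quadrant, ρ₀ x ≤ M) {t : ℝ} (ht : 0 ≤ t) {x : ℝ × ℝ} (hx : x ∈ quadrant) :
    r (t, x) ≤ M := by
  have := h.comp_eq_zero h₀ (φ := fun z => expNegInvGlue (z - M))
    (expNegInvGlue.contDiff.comp (contDiff_id.sub contDiff_const))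
    (fun z => expNegInvGlue.nonneg _)
    (fun x hx => expNegInvGlue.zero_of_nonpos (by simpa using hM x hx)) ht x hx
  simpa using this

/-- The density times an odd function that is nonnegative on `[0, π]` is nonnegative. -/
theorem IsFlowFrom.mul_nonneg (h : IsFlowFrom ρ₀ r u v p) (h₀ : IsStripData ρ₀) {t : ℝ}
    (ht : 0 ≤ t) {β : ℝ → ℝ} (hβ : ∀ b, β (-b) = -β b) (hβ0 : ∀ b ∈ Icc 0 π, 0 ≤ β b)
    {x : ℝ × ℝ} (hx : x ∈ cell) : 0 ≤ r (t, x) * β x.2 := by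
  obtain ⟨a, b⟩ := x
  have h1 : ∀ a' ∈ Icc (-π) π, 0 ≤ a' → 0 ≤ r (t, a', b) * β b := by
    intro a' ha' ha0
    rcases le_total 0 b with hb | hb
    · exact _root_.mul_nonneg (h.nonneg h₀ ht ⟨⟨ha0, ha'.2⟩, hb, hx.2.2⟩) (hβ0 b ⟨hb, hx.2.2⟩)
    · have hb' : -b ∈ Icc 0 π := ⟨by linarith, by linarith [hx.2.1]⟩
      have := _root_.mul_nonneg (h.nonneg h₀ ht (x := (a', -b)) ⟨⟨ha0, ha'.2⟩, hb'⟩) (hβ0 _ hb')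
      rw [(h.odd h₀ ht ha' hx.2).1, hβ, neg_mul_neg] at this
      exact this
  rcases le_total 0 a with ha | ha
  · exact h1 a hx.1 ha
  · have ha' : -a ∈ Icc (-π) π := ⟨by linarith [hx.1.2, pi_pos], by linarith [hx.1.1]⟩
    have := h1 (-a) ha' (by linarith)
    rwa [(h.even h₀ ht hx.1 hx.2).1] at this

/-- The density vanishes for `x₁ = 0` at all times: there it satisfies a one-dimensional transport
equation. -/
theorem IsFlowFrom.zero_axis (h : IsFlowFrom ρ₀ r u v p) (h₀ : IsStripData ρ₀) {t b : ℝ}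
    (ht : 0 ≤ t) (hb : b ∈ Icc (-π) π) : r (t, 0, b) = 0 := by
  obtain ⟨L, hL⟩ := exists_bound_gradient h.smooth_v (t + 1) (-π) π
  have hT : 0 < t + 1 := by linarith
  have hππ : -π < π := by linarith [pi_pos]
  set B := box (t + 1) (-π) π (-π) π with hB
  have hsub : B ⊆ spaceTime := box_subset_spaceTime le_rfl le_rfl
  -- the weight `e^{-Kt}` absorbs the factor `∂₂v ≤ L` that appears because the restriction of the
  -- velocity to the line `x₁ = 0` is not divergence-free
  set K : ℝ := L + 1 with hK
  have hE : ContDiffOn ℝ 1 (fun q : ℝ × ℝ × ℝ => exp (-(K * q.1))) B := by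
    apply ContDiff.contDiffOn; fun_prop
  -- `reflection 0 1` is the projection to the line `x₁ = 0`
  have hm : MapsTo (reflection 0 1) spaceTime spaceTime := mapsTo_reflection (Or.inl rfl)
  have sr' : ContDiffOn ℝ 1 (fun q => 1 * r (reflection 0 1 q)) spaceTime :=
    contDiffOn_const.mul (h.smooth_r.comp (reflection 0 1).contDiff.contDiffOn hm)
  have sv' : ContDiffOn ℝ 1 (fun q => 1 * v (reflection 0 1 q)) spaceTime :=
    contDiffOn_const.mul (h.smooth_v.comp (reflection 0 1).contDiff.contDiffOn hm)
  have sr := (sr'.mono hsub).pow 2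
  have key := eq_zero_of_div_le hT hππ hππ
    (F₀ := fun q => exp (-(K * q.1)) * (1 * r (reflection 0 1 q)) ^ 2)
    (F₁ := fun q => 0)
    (F₂ := fun q => exp (-(K * q.1)) *
      ((1 * v (reflection 0 1 q)) * (1 * r (reflection 0 1 q)) ^ 2))
    (G := fun q => exp (-(K * q.1)) * (1 * r (reflection 0 1 q)) ^ 2)
    (hE.mul sr) contDiffOn_const (hE.mul ((sv'.mono hsub).mul sr))
    (fun _ _ _ _ => rfl)
    (fun τ hτ x hx => by
      have := h.no_flow τ hτ.1 0
      simp [this.1, this.2])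
    (hE.mul sr).continuousOn (fun q _ => by positivity)
    (fun x hx => by
      have : r (0, 0, x.2) = 0 :=
        (h.init (0, x.2) ⟨mem_univ _, hx.2⟩).trans (h₀.zero_axis _ hx.2)
      obtain ⟨a, b⟩ := x
      simp only at this
      simp [this])
    (fun x hx => by positivity)
    (fun q hq => by
      have hqi := interior_mono hsub hq
      have hRi : reflection 0 1 q ∈ interior spaceTime :=
        mapsTo_reflection_interior (Or.inl rfl) hqi
      have dE := hasFDerivAt_exp_time K q
      have dr := hasFDerivAt_of_interior sr' hqi
      have dv := hasFDerivAt_of_interior sv' hqi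
      have e0 := (dE.mul (dr.pow 2)).fderiv
      have e2 := (dE.mul (dv.mul (dr.pow 2))).fderiv
      obtain ⟨r0, -, r2⟩ := fderiv_reflection h.smooth_r (σ := 0) (Or.inl rfl) 1 hqi
      obtain ⟨-, -, v2⟩ := fderiv_reflection h.smooth_v (σ := 0) (Or.inl rfl) 1 hqi
      have t0 := h.transport _ hRi
      have hRq : reflection 0 1 q ∈ interior B := by
        rw [interior_box] at hq
        rw [hB, interior_box]
        exact ⟨hq.1, by simp [reflection, pi_pos], by simpa [reflection] using hq.2.2⟩
      have l2 := (hL _ hRq).2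
      have hu0 : u (reflection 0 1 q) = 0 := by
        obtain ⟨τ, x, y⟩ := q
        rw [reflection_apply, zero_mul, one_mul]
        have := interior_subset hqi
        exact (h.u_eq_zero h₀ this.1 this.2.2).1
      rw [hu0] at t0
      have hdiv : dT (fun q => exp (-(K * q.1)) * (1 * r (reflection 0 1 q)) ^ 2) q
          + dX (fun _ => 0) q + dY (fun q => exp (-(K * q.1)) *
            ((1 * v (reflection 0 1 q)) * (1 * r (reflection 0 1 q)) ^ 2)) q
          = exp (-(K * q.1)) * (dY v (reflection 0 1 q) - K) * r (reflection 0 1 q) ^ 2 := by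
        simp only [dT, dX, dY] at r0 r2 v2 t0 ⊢
        erw [e0, e2]
        simp only [add_apply, smul_apply, neg_apply, smul_eq_mul, r0, r2, v2]
        simp
        linear_combination exp (-(K * q.1)) * 2 * r (reflection 0 1 q) * t0
      rw [hdiv]
      have h5 : 0 ≤ exp (-(K * q.1)) * r (reflection 0 1 q) ^ 2 := by positivity
      have h6 := (abs_le.1 l2).2
      rw [hK] at h5 ⊢
      nlinarith)
  have := key (t, 0, b) ⟨⟨ht, by linarith⟩, ⟨by linarith [pi_pos], pi_pos.le⟩, hb⟩
  have h4 := (mul_eq_zero.1 this).resolve_left (exp_pos _).ne'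
  simpa using h4

/-- The potential energy is nonincreasing; its dissipation is the kinetic energy. -/
theorem IsFlowFrom.integral_velocity_le (h : IsFlowFrom ρ₀ r u v p) (h₀ : IsStripData ρ₀) {T : ℝ}
    (hT : 0 < T) :
    IntegrableOn (fun q => u q ^ 2 + v q ^ 2) (box T (-π) π (-π) π) ∧
    ∫ q in box T (-π) π (-π) π, (u q ^ 2 + v q ^ 2) ≤ ∫ x in cell, ρ₀ x * x.2 := by
  have hππ : -π < π := by linarith [pi_pos]
  have hsub : box T (-π) π (-π) π ⊆ spaceTime := box_subset_spaceTime le_rfl le_rfl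
  have sy : ContDiffOn ℝ 1 (fun q : ℝ × ℝ × ℝ => q.2.2) (box T (-π) π (-π) π) := by
    apply ContDiff.contDiffOn; fun_prop
  have sr := (h.smooth_r.mono hsub).mul sy
  have sP := sr.add (h.smooth_p.mono hsub)
  -- the density `ρ x₂` has the flux `u (ρ x₂ + p)`
  obtain ⟨hi, key⟩ := integral_div_box hT hππ hππ (F₀ := fun q => r q * q.2.2)
    (F₁ := fun q => u q * (r q * q.2.2 + p q)) (F₂ := fun q => v q * (r q * q.2.2 + p q))
    (g := fun q => -(u q ^ 2 + v q ^ 2)) sr ((h.smooth_u.mono hsub).mul sP)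
    ((h.smooth_v.mono hsub).mul sP)
    (fun t ht y hy => by
      simp only [h.periodic_r t ht.1 y hy, h.periodic_u t ht.1 y hy, h.periodic_p t ht.1 y hy])
    (fun t ht x hx => by
      simp only [h.no_flow t ht.1 x, zero_mul])
    (fun q hq => by
      have hqi := interior_mono hsub hq
      have dy : HasFDerivAt (fun q : ℝ × ℝ × ℝ => q.2.2) ((ContinuousLinearMap.snd ℝ ℝ ℝ).comp
        (ContinuousLinearMap.snd ℝ ℝ (ℝ × ℝ))) q := hasFDerivAt_snd.comp q hasFDerivAt_snd
      have dr := (hasFDerivAt_of_interior h.smooth_r hqi).mul dy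
      have dP := dr.add (hasFDerivAt_of_interior h.smooth_p hqi)
      have e0 := dr.fderiv
      have e1 := ((hasFDerivAt_of_interior h.smooth_u hqi).mul dP).fderiv
      have e2 := ((hasFDerivAt_of_interior h.smooth_v hqi).mul dP).fderiv
      have t0 := h.transport q hqi
      have t1 := h.div_free q hqi
      have t2 := h.darcy1 q hqi
      have t3 := h.darcy2 q hqi
      simp only [dT, dX, dY] at t0 t1 t2 t3 ⊢
      erw [e0, e1, e2]
      simp
      linear_combination q.2.2 * t0 + (r q * q.2.2 + p q) * t1 + u q * t2 + v q * t3)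
  refine ⟨hi.neg.congr (ae_of_all _ fun q => neg_neg _), ?_⟩
  rw [integral_neg] at key
  have h1 : 0 ≤ ∫ x in cell, r (T, x) * x.2 :=
    setIntegral_nonneg isCompact_cell.measurableSet fun x hx =>
      h.mul_nonneg h₀ hT.le (β := fun b => b) (fun _ => rfl) (fun b hb => hb.1) hx
  have h2 : ∫ x in cell, r (0, x) * x.2 = ∫ x in cell, ρ₀ x * x.2 :=
    setIntegral_congr_fun isCompact_cell.measurableSet fun x hx => by
      simp only [h.init x (cell_subset_strip hx)]
  simp only [cell] at h1 h2 ⊢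
  linarith

theorem IsStripData.integral_quadrant_pos (h₀ : IsStripData ρ₀) : 0 < ∫ x in quadrant, ρ₀ x := by
  have hc : ContinuousOn ρ₀ quadrant :=
    h₀.smooth.continuousOn.mono (quadrant_subset_cell.trans cell_subset_strip)
  have hnn : ∀ x ∈ quadrant, 0 ≤ ρ₀ x := fun x hx => h₀.nonneg x.1 hx.1 x.2 hx.2
  have hm := isCompact_quadrant.measurableSet
  refine (setIntegral_nonneg hm hnn).lt_of_ne' fun h0 => ?_
  rw [setIntegral_eq_zero_iff_of_nonneg_ae ((ae_restrict_iff' hm).2 (ae_of_all _ hnn))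
    (hc.integrableOn_compact isCompact_quadrant)] at h0
  have hz : ∀ x ∈ quadrant, ρ₀ x = 0 :=
    Measure.eqOn_of_ae_eq (g := fun _ => 0) h0 hc continuousOn_const
      quadrant_subset_closure_interior
  obtain ⟨⟨a, b⟩, ⟨-, hb⟩, hne⟩ := h₀.nonzero
  have hp : Function.Periodic (fun a => ρ₀ (a, b)) (2 * π) := fun a => h₀.periodic a b hb
  obtain ⟨a', ha', he⟩ := hp.exists_mem_Ico two_pi_pos a (-π)
  refine hne (he.trans ?_)
  have h1 : ∀ a₁ ∈ Icc 0 π, ρ₀ (a₁, b) = 0 := by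
    intro a₁ ha₁
    rcases le_total 0 b with hb0 | hb0
    · exact hz _ ⟨ha₁, hb0, hb.2⟩
    · have := hz (a₁, -b) ⟨ha₁, by linarith, by linarith [hb.1]⟩
      rw [h₀.odd2 _ _ hb] at this
      linarith
  rcases le_total 0 a' with ha | ha
  · exact h1 a' ⟨ha, by linarith [ha'.2]⟩
  · have := h1 (-a') ⟨by linarith, by linarith [ha'.1]⟩
    rwa [h₀.even1 _ _ hb] at this

/-- The first vertical moment of the density is bounded below for all times: the mass and the upper
bound of the density in the quadrant are conserved, so that the mass cannot concentrate near the
lines where `sin x₂` vanishes. -/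
theorem IsStripData.exists_moment_lower_bound (h₀ : IsStripData ρ₀) :
    ∃ c, 0 < c ∧ ∀ r u v p : ℝ × ℝ × ℝ → ℝ, IsFlowFrom ρ₀ r u v p → ∀ t, 0 ≤ t →
      c ≤ ∫ x in cell, r (t, x) * sin x.2 := by
  have hm := isCompact_quadrant.measurableSet
  have hsub := quadrant_subset_cell.trans cell_subset_strip
  have hI := h₀.integral_quadrant_pos
  set I := ∫ x in quadrant, ρ₀ x with hIdef
  obtain ⟨M, hM⟩ := isCompact_quadrant.exists_bound_of_continuousOn
    (h₀.smooth.continuousOn.mono hsub)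
  have hM0 : 0 ≤ M := (norm_nonneg _).trans (hM (0, 0) ⟨⟨le_rfl, pi_pos.le⟩, le_rfl, pi_pos.le⟩)
  have hsin : ∀ x ∈ quadrant, 0 ≤ sin x.2 := fun x hx => sin_nonneg_of_mem_Icc hx.2
  -- `ρ ≤ n ρ sin x₂ + M max(0, 1 - n sin x₂)` for `0 ≤ ρ ≤ M`, and the last term is small in the mean
  have hlim : Tendsto (fun n : ℕ => ∫ x in quadrant, M * max 0 (1 - n * sin x.2)) atTop
      (nhds (∫ x in quadrant, (0 : ℝ))) := by
    refine tendsto_integral_of_dominated_convergence (fun _ => M) (fun n => ?_) ?_ (fun n => ?_) ?_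
    · exact Continuous.aestronglyMeasurable (by fun_prop)
    · exact integrableOn_const isCompact_quadrant.measure_lt_top.ne
    · refine (ae_restrict_iff' hm).2 (ae_of_all _ fun x hx => ?_)
      have h1 : (0 : ℝ) ≤ n * sin x.2 := by have := hsin x hx; positivity
      rw [norm_mul, norm_of_nonneg hM0, norm_of_nonneg (le_max_left _ _)]
      exact mul_le_of_le_one_right hM0 (max_le zero_le_one (by linarith))
    · have hint : ∀ᵐ x ∂(volume.restrict quadrant), x ∈ interior quadrant := by
        have : Convex ℝ quadrant := (convex_Icc _ _).prod (convex_Icc _ _)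
        have : (volume : Measure (ℝ × ℝ)).IsAddHaarMeasure :=
          Measure.prod.instIsAddHaarMeasure _ _
        have hf : volume (frontier quadrant) = 0 := Convex.addHaar_frontier volume ‹_›
        rw [ae_restrict_iff' hm]
        filter_upwards [measure_eq_zero_iff_ae_notMem.1 hf] with x hx hxq
        by_contra hc
        exact hx ⟨subset_closure hxq, hc⟩
      filter_upwards [hint] with x hx
      rw [quadrant, interior_prod_eq, interior_Icc] at hx
      have hs : 0 < sin x.2 := sin_pos_of_mem_Ioo hx.2
      obtain ⟨N, hN⟩ := exists_nat_gt (1 / sin x.2)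
      refine tendsto_const_nhds.congr' ?_
      filter_upwards [eventually_ge_atTop N] with n hn
      have h1 : 1 < n * sin x.2 := by
        have : 1 / sin x.2 < n := hN.trans_le (by exact_mod_cast hn)
        rwa [div_lt_iff₀ hs] at this
      rw [max_eq_left (by linarith), mul_zero]
  rw [integral_zero] at hlim
  obtain ⟨n, hn1, hn⟩ := ((hlim.eventually_lt_const (half_pos hI)).and
    (eventually_ge_atTop 1)).exists
  have hn0 : (0 : ℝ) < n := by exact_mod_cast hn
  refine ⟨I / (2 * n), by positivity, fun r u v p h t ht => ?_⟩
  have hrc := continuousOn_slice h.smooth_r ht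
  have hi1 : IntegrableOn (fun x => r (t, x) * sin x.2) cell :=
    ((hrc.mono cell_subset_strip).mul (by fun_prop)).integrableOn_compact isCompact_cell
  have hi2 : IntegrableOn (fun x : ℝ × ℝ => M * max 0 (1 - n * sin x.2)) quadrant :=
    (Continuous.continuousOn (by fun_prop)).integrableOn_compact isCompact_quadrant
  have h1 : ∫ x in quadrant, r (t, x) * sin x.2 ≤ ∫ x in cell, r (t, x) * sin x.2 :=
    setIntegral_mono_set hi1 ((ae_restrict_iff' isCompact_cell.measurableSet).2
      (ae_of_all _ fun x hx => h.mul_nonneg h₀ ht sin_neg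
        (fun b hb => sin_nonneg_of_mem_Icc hb) hx)) quadrant_subset_cell.eventuallyLE
  have h2 : I = ∫ x in quadrant, r (t, x) :=
    (h.integral_quadrant_comp h₀ (φ := fun z => z) contDiff_id ht).symm
  have h3 : ∫ x in quadrant, r (t, x) ≤
      ∫ x in quadrant, (n * (r (t, x) * sin x.2) + M * max 0 (1 - n * sin x.2)) := by
    refine setIntegral_mono_on ((hrc.mono hsub).integrableOn_compact isCompact_quadrant)
      (((hi1.mono_set quadrant_subset_cell).const_mul _).add hi2) hm fun x hx => ?_
    have a1 := h.nonneg h₀ ht hx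
    have a2 : r (t, x) ≤ M := h.le h₀ (fun x hx => (le_abs_self _).trans (hM x hx)) ht hx
    have a3 := hsin x hx
    rcases le_total (1 - n * sin x.2) 0 with h0 | h0
    · rw [max_eq_left h0]
      nlinarith
    · rw [max_eq_right h0]
      nlinarith
  have h4 := integral_add ((hi1.mono_set quadrant_subset_cell).const_mul (n : ℝ)) hi2
  have h5 : ∫ x in quadrant, n * (r (t, x) * sin x.2) = n * ∫ x in quadrant, r (t, x) * sin x.2 :=
    integral_const_mul _ _
  rw [h4, h5] at h3
  rw [div_le_iff₀ (by positivity)]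
  nlinarith

end

/-! ### Fourier coefficients of vertical moments -/

/-- The integral over the cell of `g` against `e^{-i k x₁} β(x₂)`. -/
noncomputable def modeCoeff (β : ℝ → ℂ) (g : ℝ × ℝ → ℝ) (k : ℤ) : ℂ :=
  ∫ x in cell, Complex.exp (-(Complex.I * ((k : ℂ) * (x.1 : ℂ)))) * β x.2 * (g x : ℂ)

/-- The vertical moment `∫ β(x₂) g(x₁, x₂) dx₂`, as a function of `x₁`. -/
noncomputable def vMoment (β : ℝ → ℂ) (g : ℝ × ℝ → ℝ) (a : ℝ) : ℂ :=
  ∫ b in Icc (-π) π, β b * (g (a, b) : ℂ)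

theorem continuousOn_mode {β : ℝ → ℂ} (hβ : Continuous β) {g : ℝ × ℝ → ℝ} {s : Set (ℝ × ℝ)}
    (hg : ContinuousOn g s) (k : ℤ) :
    ContinuousOn (fun x : ℝ × ℝ =>
      Complex.exp (-(Complex.I * ((k : ℂ) * (x.1 : ℂ)))) * β x.2 * (g x : ℂ)) s :=
  ContinuousOn.mul (by fun_prop) (Complex.continuous_ofReal.comp_continuousOn hg)

theorem modeCoeff_eq_integral {β : ℝ → ℂ} (hβ : Continuous β) {g : ℝ × ℝ → ℝ}
    (hg : ContinuousOn g strip) (k : ℤ) :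
    modeCoeff β g k =
      ∫ a in Icc (-π) π, Complex.exp (-(Complex.I * ((k : ℂ) * (a : ℂ)))) * vMoment β g a := by
  have hi : IntegrableOn (fun x : ℝ × ℝ =>
      Complex.exp (-(Complex.I * ((k : ℂ) * (x.1 : ℂ)))) * β x.2 * (g x : ℂ)) cell :=
    (continuousOn_mode hβ (hg.mono cell_subset_strip) k).integrableOn_compact isCompact_cell
  refine (setIntegral_prod (μ := volume) (ν := volume) _ hi).trans ?_
  refine setIntegral_congr_fun measurableSet_Icc fun a _ => ?_
  simp only [vMoment, mul_assoc]
  exact integral_const_mul _ _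

theorem continuous_vMoment {β : ℝ → ℂ} (hβ : Continuous β) {g : ℝ × ℝ → ℝ}
    (hg : ContinuousOn g strip) : Continuous (vMoment β g) := by
  have hππ : -π ≤ π := by linarith [pi_pos]
  have h1 : Continuous fun x : ℝ × ℝ => g (x.1, (projIcc (-π) π hππ x.2 : ℝ)) :=
    hg.comp_continuous (by fun_prop) fun x => ⟨mem_univ _, (projIcc (-π) π hππ x.2).2⟩
  have h2 : Continuous (Function.uncurry fun a b : ℝ =>
      β b * (g (a, (projIcc (-π) π hππ b : ℝ)) : ℂ)) :=
    (hβ.comp continuous_snd).mul (Complex.continuous_ofReal.comp h1)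
  have h3 := continuous_parametric_integral_of_continuous (μ := volume) h2
    (isCompact_Icc (a := -π) (b := π))
  convert! h3 using 1
  ext a
  refine setIntegral_congr_fun measurableSet_Icc fun b hb => ?_
  simp only [projIcc_of_mem hππ hb]

/-- Parseval's identity on `[-π, π]`, with unnormalized coefficients. -/
theorem hasSum_sq_norm_fourier {G : ℝ → ℂ} (hG : Continuous G) :
    HasSum (fun k : ℤ =>
      ‖∫ a in Icc (-π) π, Complex.exp (-(Complex.I * ((k : ℂ) * (a : ℂ)))) * G a‖ ^ 2)
      (2 * π * ∫ a in Icc (-π) π, ‖G a‖ ^ 2) := by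
  have hππ : -π < π := by linarith [pi_pos]
  have hL : MemLp G 2 (volume.restrict (Ioc (-π) π)) := by
    obtain ⟨C, hC⟩ := isCompact_Icc.exists_bound_of_continuousOn (hG.continuousOn (s := Icc (-π) π))
    refine MemLp.of_bound hG.aestronglyMeasurable C ?_
    exact (ae_restrict_iff' measurableSet_Ioc).2 (ae_of_all _ fun x hx =>
      hC x (Ioc_subset_Icc_self hx))
  have h := (hasSum_sq_fourierCoeffOn hππ hL).mul_left ((2 * π) ^ 2)
  have hπ := pi_pos.ne'
  convert! h using 1
  · ext k
    rw [fourierCoeffOn_eq_integral, norm_smul, mul_pow ‖1 / (π - -π)‖,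
      intervalIntegral.integral_of_le hππ.le,
      ← integral_Icc_eq_integral_Ioc]
    have : (2 * π) ^ 2 * ‖1 / (π - -π)‖ ^ 2 = 1 := by
      rw [norm_of_nonneg (by simp [pi_pos.le])]
      field_simp
      ring
    rw [← mul_assoc, this, one_mul]
    congr 3
    ext a
    rw [fourier_coe_apply, smul_eq_mul]
    congr 2
    have : (π : ℂ) ≠ 0 := by exact_mod_cast hπ
    push_cast
    field_simp
    ring
  · rw [intervalIntegral.integral_of_le hππ.le, ← integral_Icc_eq_integral_Ioc, smul_eq_mul]
    field_simp
    ring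

/-- If the coefficients of a continuous `2π`-periodic function are summable, then they sum to
`2π` times its value at `0`. -/
theorem hasSum_fourier_of_summable {G : ℝ → ℂ} (hG : Continuous G)
    (hp : Function.Periodic G (2 * π))
    (hs : Summable fun k : ℤ =>
      ∫ a in Icc (-π) π, Complex.exp (-(Complex.I * ((k : ℂ) * (a : ℂ)))) * G a) :
    HasSum (fun k : ℤ =>
      ∫ a in Icc (-π) π, Complex.exp (-(Complex.I * ((k : ℂ) * (a : ℂ)))) * G a)
      (2 * π * G 0) := by
  have : Fact (0 < 2 * π) := ⟨two_pi_pos⟩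
  have hππ : -π < π := by linarith [pi_pos]
  have hπ : (π : ℂ) ≠ 0 := by exact_mod_cast pi_pos.ne'
  let F : C(AddCircle (2 * π), ℂ) := ⟨hp.lift, continuous_coinduced_dom.2 hG⟩
  have hF : ∀ a : ℝ, F (a : AddCircle (2 * π)) = G a := fun a => rfl
  have hc : ∀ k : ℤ, ∫ a in Icc (-π) π, Complex.exp (-(Complex.I * ((k : ℂ) * (a : ℂ)))) * G a
      = (2 * π) * fourierCoeff F k := by
    intro k
    rw [fourierCoeff_eq_intervalIntegral F k (-π), show -π + 2 * π = π by ring,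
      intervalIntegral.integral_of_le hππ.le, ← integral_Icc_eq_integral_Ioc]
    have h1 : ∀ a : ℝ, fourier (-k) (a : AddCircle (2 * π)) • F (a : AddCircle (2 * π))
        = Complex.exp (-(Complex.I * ((k : ℂ) * (a : ℂ)))) * G a := by
      intro a
      rw [fourier_coe_apply, smul_eq_mul, hF]
      congr 2
      push_cast
      field_simp
    simp only [h1]
    rw [Complex.real_smul]
    push_cast
    field_simp
  simp only [hc] at hs ⊢
  have h2 : (2 * π : ℂ) ≠ 0 := by simp [hπ]
  have hs' : Summable (fourierCoeff F) := (summable_mul_left_iff h2).1 hs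
  have := has_pointwise_sum_fourier_series_of_summable hs' 0
  simp only [fourier_eval_zero, smul_eq_mul, mul_one] at this
  have h0 : F 0 = G 0 := hF 0
  rw [h0] at this
  exact this.mul_left _

/-- Jensen's inequality for the square on `[-π, π]`. -/
theorem sq_setIntegral_le {f : ℝ → ℝ} (hf : ContinuousOn f (Icc (-π) π)) :
    (∫ b in Icc (-π) π, f b) ^ 2 ≤ 2 * π * ∫ b in Icc (-π) π, f b ^ 2 := by
  set m := ∫ b in Icc (-π) π, f b with hm
  have h1 := hf.integrableOn_compact (μ := volume) isCompact_Icc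
  have h2 := (hf.pow 2).integrableOn_compact (μ := volume) isCompact_Icc
  have h0 : 0 ≤ ∫ b in Icc (-π) π, (2 * π * f b - m) ^ 2 :=
    setIntegral_nonneg measurableSet_Icc fun _ _ => sq_nonneg _
  have e : ∀ b, (2 * π * f b - m) ^ 2 = (2 * π) ^ 2 * f b ^ 2 - 2 * (2 * π) * m * f b + m ^ 2 :=
    fun b => by ring
  have e1 : ∫ b in Icc (-π) π, (2 * π * f b - m) ^ 2
      = (2 * π) ^ 2 * (∫ b in Icc (-π) π, f b ^ 2) - 2 * (2 * π) * m * m + m ^ 2 * (2 * π) := by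
    simp only [e]
    have i1 : IntegrableOn (fun b => (2 * π) ^ 2 * f b ^ 2) (Icc (-π) π) := h2.const_mul _
    have i2 : IntegrableOn (fun b => 2 * (2 * π) * m * f b) (Icc (-π) π) := h1.const_mul _
    have i3 : IntegrableOn (fun _ : ℝ => m ^ 2) (Icc (-π) π) :=
      continuousOn_const.integrableOn_compact isCompact_Icc
    have a1 := integral_add (i1.sub i2) i3
    have a2 := integral_sub i1 i2
    have a3 : ∫ b in Icc (-π) π, (2 * π) ^ 2 * f b ^ 2 = (2 * π) ^ 2 * ∫ b in Icc (-π) π, f b ^ 2 :=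
      integral_const_mul _ _
    have a4 : ∫ b in Icc (-π) π, 2 * (2 * π) * m * f b = 2 * (2 * π) * m * m :=
      integral_const_mul _ _
    have a5 : ∫ _ in Icc (-π) π, m ^ 2 = m ^ 2 * (2 * π) := by
      rw [setIntegral_const, measureReal_def, Real.volume_Icc,
        ENNReal.toReal_ofReal (by linarith [pi_pos]), smul_eq_mul]
      ring
    simp only [Pi.sub_apply] at a1
    rw [a1, a2, a3, a4, a5]
  rw [e1] at h0
  have hπ := pi_pos
  have : 0 ≤ 2 * π * (2 * π * (∫ b in Icc (-π) π, f b ^ 2) - m ^ 2) := by linarith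
  have := nonneg_of_mul_nonneg_right this (by positivity)
  linarith

/-- Bessel's inequality for the coefficients against `e^{-i k x₁} β(x₂)`. -/
theorem tsum_sq_modeCoeff_le {β : ℝ → ℂ} (hβ : Continuous β) (hβ1 : ∀ b, ‖β b‖ ≤ 1)
    {g : ℝ × ℝ → ℝ} (hg : ContinuousOn g strip) :
    ∑' k : ℤ, ENNReal.ofReal (‖modeCoeff β g k‖ ^ 2) ≤
      ENNReal.ofReal ((2 * π) ^ 2 * ∫ x in cell, g x ^ 2) := by
  have h := hasSum_sq_norm_fourier (continuous_vMoment hβ hg)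
  simp only [← modeCoeff_eq_integral hβ hg] at h
  rw [← ENNReal.ofReal_tsum_of_nonneg (fun _ => sq_nonneg _) h.summable, h.tsum_eq]
  refine ENNReal.ofReal_le_ofReal ?_
  have hsl : ∀ a, ContinuousOn (fun b => g (a, b)) (Icc (-π) π) := fun a =>
    hg.comp (by fun_prop) fun b hb => ⟨mem_univ _, hb⟩
  have hi : IntegrableOn (fun x => g x ^ 2) cell :=
    ((hg.mono cell_subset_strip).pow 2).integrableOn_compact isCompact_cell
  have e : ∫ x in cell, g x ^ 2 = ∫ a in Icc (-π) π, ∫ b in Icc (-π) π, g (a, b) ^ 2 :=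
    setIntegral_prod (μ := volume) (ν := volume) _ hi
  have hi' : IntegrableOn (fun a => ∫ b in Icc (-π) π, g (a, b) ^ 2) (Icc (-π) π) := by
    have h1 : Integrable (fun x => g x ^ 2)
        ((volume.restrict (Icc (-π) π)).prod (volume.restrict (Icc (-π) π))) := by
      rw [Measure.prod_restrict]
      exact hi
    exact h1.integral_prod_left
  have key : ∫ a in Icc (-π) π, ‖vMoment β g a‖ ^ 2 ≤
      ∫ a in Icc (-π) π, 2 * π * ∫ b in Icc (-π) π, g (a, b) ^ 2 := by
    refine setIntegral_mono_on ?_ (hi'.const_mul _) measurableSet_Icc fun a _ => ?_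
    · exact ((continuous_vMoment hβ hg).norm.pow 2).continuousOn.integrableOn_compact isCompact_Icc
    · have h1 : ‖vMoment β g a‖ ≤ ∫ b in Icc (-π) π, |g (a, b)| := by
        refine (norm_integral_le_integral_norm _).trans ?_
        refine setIntegral_mono_on ?_ ((hsl a).abs.integrableOn_compact isCompact_Icc)
          measurableSet_Icc fun b _ => ?_
        · exact (ContinuousOn.norm (hβ.continuousOn.mul (Complex.continuous_ofReal.comp_continuousOn
            (hsl a)))).integrableOn_compact isCompact_Icc
        · rw [norm_mul, Complex.norm_real, norm_eq_abs]
          exact mul_le_of_le_one_left (abs_nonneg _) (hβ1 b)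
      have h2 := sq_setIntegral_le (hsl a).abs
      simp only [sq_abs] at h2
      exact (pow_le_pow_left₀ (norm_nonneg _) h1 2).trans h2
  have e2 : ∫ a in Icc (-π) π, 2 * π * ∫ b in Icc (-π) π, g (a, b) ^ 2
      = 2 * π * ∫ x in cell, g x ^ 2 := by
    rw [e]
    exact integral_const_mul _ _
  rw [e2] at key
  calc _ ≤ 2 * π * (2 * π * ∫ x in cell, g x ^ 2) :=
        mul_le_mul_of_nonneg_left key (by positivity)
    _ = _ := by ring

/-! ### Integration by parts in the cell -/

theorem interior_strip : interior strip = univ ×ˢ Ioo (-π) π := by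
  rw [strip, interior_prod_eq, interior_univ, interior_Icc]

theorem ae_mem_interior_strip : ∀ᵐ x ∂(volume.restrict cell), x ∈ interior strip := by
  have hc : Convex ℝ cell := (convex_Icc _ _).prod (convex_Icc _ _)
  have : (volume : Measure (ℝ × ℝ)).IsAddHaarMeasure := Measure.prod.instIsAddHaarMeasure _ _
  have hf : volume (frontier cell) = 0 := hc.addHaar_frontier volume
  rw [ae_restrict_iff' isCompact_cell.measurableSet]
  filter_upwards [measure_eq_zero_iff_ae_notMem.1 hf] with x hx hxc
  by_contra hn
  exact hx ⟨subset_closure hxc, fun h => hn (interior_mono cell_subset_strip h)⟩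

/-- The divergence theorem in the cell, for a field that is periodic in `x₁` and whose second
component vanishes for `x₂ = ±π`. -/
theorem integral_div_cell {f g D : ℝ × ℝ → ℂ}
    (hf : ContinuousOn f strip) (hg : ContinuousOn g strip)
    (hdiv : ∀ x ∈ interior strip, ∃ f' g' : ℝ × ℝ →L[ℝ] ℂ,
      HasFDerivAt f f' x ∧ HasFDerivAt g g' x ∧ f' (1, 0) + g' (0, 1) = D x)
    (hper : ∀ b ∈ Icc (-π) π, f (π, b) = f (-π, b))
    (hg0 : ∀ a, g (a, π) = 0 ∧ g (a, -π) = 0) (hD : IntegrableOn D cell) :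
    ∫ x in cell, D x = 0 := by
  choose! f' g' hf' hg' hdiv using hdiv
  have hππ : -π ≤ π := by linarith [pi_pos]
  have hcell : Icc ((-π, -π) : ℝ × ℝ) (π, π) = cell := (Icc_prod_Icc _ _ _ _).symm
  have hsub : Ioo (-π) π ×ˢ Ioo (-π) π ⊆ interior strip := by
    rw [interior_strip]
    exact prod_mono_left (subset_univ _)
  have hae : (fun x => f' x (1, 0) + g' x (0, 1)) =ᵐ[volume.restrict cell] D := by
    filter_upwards [ae_mem_interior_strip] with x hx using hdiv x hx
  have key := integral_divergence_prod_Icc_of_hasFDerivAt_of_le f g f' g' (-π, -π) (π, π)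
    ⟨hππ, hππ⟩ (by rw [hcell]; exact hf.mono cell_subset_strip)
    (by rw [hcell]; exact hg.mono cell_subset_strip)
    (fun x hx => hf' x (hsub hx)) (fun x hx => hg' x (hsub hx))
    (by rw [hcell]; exact hD.congr hae.symm)
  rw [hcell, integral_congr_ae hae] at key
  rw [key]
  have e1 : ∫ y in (-π)..π, f (π, y) = ∫ y in (-π)..π, f (-π, y) :=
    intervalIntegral.integral_congr fun y hy => hper y (by rwa [uIcc_of_le hππ] at hy)
  simp only [hg0, e1]
  simp

theorem exp_pi_eq (k : ℤ) : Complex.exp (-(Complex.I * ((k : ℂ) * (π : ℂ)))) =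
    Complex.exp (-(Complex.I * ((k : ℂ) * ((-π : ℝ) : ℂ)))) := by
  rw [Complex.exp_eq_exp_iff_exists_int]
  exact ⟨-k, by push_cast; ring⟩

theorem exists_hasFDerivAt_mode (k : ℤ) {β : ℝ → ℂ} {β' : ℂ} {g : ℝ × ℝ → ℝ}
    {g' : ℝ × ℝ →L[ℝ] ℝ} {x : ℝ × ℝ} (hβ : HasDerivAt β β' x.2) (hg : HasFDerivAt g g' x) :
    ∃ L : ℝ × ℝ →L[ℝ] ℂ,
      HasFDerivAt (fun x : ℝ × ℝ =>
        Complex.exp (-(Complex.I * ((k : ℂ) * (x.1 : ℂ)))) * β x.2 * (g x : ℂ)) L x ∧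
      L (1, 0) = Complex.exp (-(Complex.I * ((k : ℂ) * (x.1 : ℂ)))) * β x.2 * (g' (1, 0) : ℂ)
        - Complex.I * k *
          (Complex.exp (-(Complex.I * ((k : ℂ) * (x.1 : ℂ)))) * β x.2 * (g x : ℂ)) ∧
      L (0, 1) = Complex.exp (-(Complex.I * ((k : ℂ) * (x.1 : ℂ)))) *
        (β' * (g x : ℂ) + β x.2 * (g' (0, 1) : ℂ)) := by
  have h1 : HasFDerivAt (fun x : ℝ × ℝ => (x.1 : ℂ))
      (Complex.ofRealCLM.comp (ContinuousLinearMap.fst ℝ ℝ ℝ)) x :=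
    Complex.ofRealCLM.hasFDerivAt.comp x hasFDerivAt_fst
  have h2 : HasFDerivAt (fun x : ℝ × ℝ => β x.2) ((ContinuousLinearMap.toSpanSingleton ℝ β').comp
      (ContinuousLinearMap.snd ℝ ℝ ℝ)) x := hβ.hasFDerivAt.comp x hasFDerivAt_snd
  have h3 : HasFDerivAt (fun x : ℝ × ℝ => (g x : ℂ)) (Complex.ofRealCLM.comp g') x :=
    Complex.ofRealCLM.hasFDerivAt.comp x hg
  refine ⟨_, (((h1.const_mul (k : ℂ)).const_mul Complex.I).neg.cexp.mul h2).mul h3, ?_, ?_⟩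
  · simp
    ring
  · simp
    ring

/-- Differentiation in `x₁` multiplies the coefficients by `i k`. -/
theorem modeCoeff_partial1 {β : ℝ → ℂ} (hβ : Differentiable ℝ β) {g : ℝ × ℝ → ℝ}
    (hg : ContDiffOn ℝ 1 g strip) (hp : StripPeriodic g) (k : ℤ) :
    modeCoeff β (partial1 g) k = Complex.I * k * modeCoeff β g k := by
  have hU : UniqueDiffOn ℝ strip := by
    refine uniqueDiffOn_convex (convex_univ.prod (convex_Icc _ _)) ?_
    rw [interior_strip]
    exact ⟨(0, 0), by simp [pi_pos]⟩
  have hgd : ∀ x ∈ interior strip, HasFDerivAt g (fderiv ℝ g x) x := fun x hx =>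
    ((hg.differentiableOn one_ne_zero).differentiableAt (mem_interior_iff_mem_nhds.1 hx)).hasFDerivAt
  have hp1 : ∀ x ∈ interior strip, partial1 g x = fderiv ℝ g x (1, 0) := by
    rintro ⟨a, b⟩ hx
    exact ((hgd _ hx).comp_hasDerivAt (f := fun s => (s, b)) a
      ((hasDerivAt_id a).prodMk (hasDerivAt_const a b))).deriv
  have i1 : IntegrableOn (fun x : ℝ × ℝ =>
      Complex.exp (-(Complex.I * ((k : ℂ) * (x.1 : ℂ)))) * β x.2 * (partial1 g x : ℂ)) cell := by
    have hc : ContinuousOn (fun x => fderivWithin ℝ g strip x (1, 0)) cell :=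
      ((hg.continuousOn_fderivWithin hU le_rfl).clm_apply continuousOn_const).mono cell_subset_strip
    refine ((continuousOn_mode hβ.continuous hc k).integrableOn_compact isCompact_cell).congr ?_
    filter_upwards [ae_mem_interior_strip] with x hx
    rw [hp1 x hx, fderivWithin_of_mem_nhds (mem_interior_iff_mem_nhds.1 hx)]
  have i2 : IntegrableOn (fun x : ℝ × ℝ =>
      Complex.exp (-(Complex.I * ((k : ℂ) * (x.1 : ℂ)))) * β x.2 * (g x : ℂ)) cell :=
    (continuousOn_mode hβ.continuous (hg.continuousOn.mono cell_subset_strip) k).integrableOn_compact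
      isCompact_cell
  have key := integral_div_cell
    (f := fun x => Complex.exp (-(Complex.I * ((k : ℂ) * (x.1 : ℂ)))) * β x.2 * (g x : ℂ))
    (g := fun _ => 0)
    (D := fun x => Complex.exp (-(Complex.I * ((k : ℂ) * (x.1 : ℂ)))) * β x.2 * (partial1 g x : ℂ)
      - Complex.I * k * (Complex.exp (-(Complex.I * ((k : ℂ) * (x.1 : ℂ)))) * β x.2 * (g x : ℂ)))
    (continuousOn_mode hβ.continuous hg.continuousOn k) continuousOn_const
    (fun x hx => by
      obtain ⟨L, hL, hL1, -⟩ := exists_hasFDerivAt_mode k (hβ x.2).hasDerivAt (hgd x hx)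
      exact ⟨L, 0, hL, hasFDerivAt_const _ _, by simp [hL1, hp1 x hx]⟩)
    (fun b hb => by
      have := hp (-π) b hb
      rw [show -π + 2 * π = π by ring] at this
      simp only [this, exp_pi_eq])
    (fun a => ⟨rfl, rfl⟩) (i1.sub (i2.const_mul _))
  have i3 := integral_sub i1 (i2.const_mul (Complex.I * k))
  rw [i3] at key
  have i4 := integral_const_mul (μ := volume.restrict cell) (Complex.I * k) (fun x : ℝ × ℝ =>
      Complex.exp (-(Complex.I * ((k : ℂ) * (x.1 : ℂ)))) * β x.2 * (g x : ℂ))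
  rw [i4] at key
  exact sub_eq_zero.1 key

/-- Darcy's law tested with the divergence-free field
`(e^{-i k x₁} cos x₂, i k e^{-i k x₁} sin x₂)`, which eliminates the pressure. -/
theorem darcy_modeCoeff {P U V R : ℝ × ℝ → ℝ} (hP : ContinuousOn P strip)
    (hU : ContinuousOn U strip) (hV : ContinuousOn V strip) (hR : ContinuousOn R strip)
    (hP' : ∀ x ∈ interior strip, ∃ P' : ℝ × ℝ →L[ℝ] ℝ,
      HasFDerivAt P P' x ∧ P' (1, 0) = -U x ∧ P' (0, 1) = -V x - R x)
    (hper : ∀ b ∈ Icc (-π) π, P (π, b) = P (-π, b)) (k : ℤ) :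
    modeCoeff (fun b => (cos b : ℂ)) U k + Complex.I * k * (modeCoeff (fun b => (sin b : ℂ)) V k
      + modeCoeff (fun b => (sin b : ℂ)) R k) = 0 := by
  have hcos : Continuous fun b : ℝ => (cos b : ℂ) := by fun_prop
  have hsin : Continuous fun b : ℝ => (sin b : ℂ) := by fun_prop
  choose! P' hP' hP1 hP2 using hP'
  have int : ∀ {β : ℝ → ℂ} {g : ℝ × ℝ → ℝ}, Continuous β → ContinuousOn g strip →
      IntegrableOn (fun x : ℝ × ℝ =>
        Complex.exp (-(Complex.I * ((k : ℂ) * (x.1 : ℂ)))) * β x.2 * (g x : ℂ)) cell :=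
    fun hβ hg => (continuousOn_mode hβ (hg.mono cell_subset_strip) k).integrableOn_compact
      isCompact_cell
  have iU := int hcos hU
  have iV := int hsin hV
  have iR := int hsin hR
  have dcos : ∀ b : ℝ, HasDerivAt (fun b : ℝ => (cos b : ℂ)) (-(sin b : ℂ)) b := fun b => by
    have := (hasDerivAt_cos b).ofReal_comp
    simpa using this
  have dsin : ∀ b : ℝ, HasDerivAt (fun b : ℝ => (sin b : ℂ)) (cos b : ℂ) b := fun b =>
    (hasDerivAt_sin b).ofReal_comp
  refine (fun key => ?_) (integral_div_cell
    (f := fun x => -(Complex.exp (-(Complex.I * ((k : ℂ) * (x.1 : ℂ)))) * (cos x.2 : ℂ) * (P x : ℂ)))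
    (g := fun x => -(Complex.I * k *
      (Complex.exp (-(Complex.I * ((k : ℂ) * (x.1 : ℂ)))) * (sin x.2 : ℂ) * (P x : ℂ))))
    (D := fun x =>
      Complex.exp (-(Complex.I * ((k : ℂ) * (x.1 : ℂ)))) * (cos x.2 : ℂ) * (U x : ℂ)
      + Complex.I * k *
        (Complex.exp (-(Complex.I * ((k : ℂ) * (x.1 : ℂ)))) * (sin x.2 : ℂ) * (V x : ℂ)
        + Complex.exp (-(Complex.I * ((k : ℂ) * (x.1 : ℂ)))) * (sin x.2 : ℂ) * (R x : ℂ)))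
    ?_ ?_ ?_ ?_ ?_ ?_)
  · have e0 := integral_add iU ((iV.add iR).const_mul (Complex.I * k))
    simp only [Pi.add_apply] at e0
    rw [e0] at key
    have e1 := integral_const_mul (μ := volume.restrict cell) (Complex.I * k) (fun x : ℝ × ℝ =>
      Complex.exp (-(Complex.I * ((k : ℂ) * (x.1 : ℂ)))) * (sin x.2 : ℂ) * (V x : ℂ)
        + Complex.exp (-(Complex.I * ((k : ℂ) * (x.1 : ℂ)))) * (sin x.2 : ℂ) * (R x : ℂ))
    rw [e1, integral_add iV iR] at key
    exact key
  · exact (continuousOn_mode hcos hP k).neg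
  · exact (continuousOn_const.mul (continuousOn_mode hsin hP k)).neg
  · intro x hx
    obtain ⟨L, hL, hL1, -⟩ := exists_hasFDerivAt_mode k (dcos x.2) (hP' x hx)
    obtain ⟨M, hM, -, hM2⟩ := exists_hasFDerivAt_mode k (dsin x.2) (hP' x hx)
    refine ⟨-L, -((Complex.I * k) • M), hL.neg, (hM.const_mul (Complex.I * k)).neg, ?_⟩
    simp only [neg_apply, smul_apply, smul_eq_mul, hL1, hM2, hP1 x hx, hP2 x hx]
    push_cast
    ring
  · intro b hb
    simp only [hper b hb, exp_pi_eq]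
  · intro a
    simp
  · exact iU.add ((iV.add iR).const_mul _)

/-! ### The interpolation inequality -/

theorem tsum_rpow_tail_le {σ : ℝ} (hσ : 1 / 2 < σ) {N : ℕ} (hN : 1 ≤ N) :
    Summable (fun n : ℕ => ((n : ℝ) + 1 + N) ^ (-(2 * σ))) ∧
    ∑' n : ℕ, ((n : ℝ) + 1 + N) ^ (-(2 * σ)) ≤ (N : ℝ) ^ (-(2 * σ - 1)) / (2 * σ - 1) := by
  have hN0 : (0 : ℝ) < N := by exact_mod_cast hN
  have hanti : AntitoneOn (fun x : ℝ => (x + N) ^ (-(2 * σ))) (Ici 0) := by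
    intro x hx y _ hxy
    have hx0 : (0 : ℝ) ≤ x := hx
    exact rpow_le_rpow_of_nonpos (by linarith) (by linarith) (by linarith)
  have hpre : (fun x : ℝ => x + N) ⁻¹' Ioi (N : ℝ) = Ioi 0 := by
    ext x
    simp
  have hmp : MeasurePreserving (fun x : ℝ => x + (N : ℝ)) volume volume :=
    measurePreserving_add_right volume (N : ℝ)
  have hemb : MeasurableEmbedding (fun x : ℝ => x + (N : ℝ)) := measurableEmbedding_addRight _
  have hint : IntegrableOn (fun x : ℝ => (x + N) ^ (-(2 * σ))) (Ioi 0) := by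
    rw [← hpre]
    exact (hmp.integrableOn_comp_preimage hemb).2
      (integrableOn_Ioi_rpow_of_lt (by linarith) hN0)
  have hval : ∫ x in Ioi (0 : ℝ), (x + N) ^ (-(2 * σ)) = (N : ℝ) ^ (-(2 * σ - 1)) / (2 * σ - 1) := by
    rw [← hpre, hmp.setIntegral_preimage_emb hemb (fun x : ℝ => x ^ (-(2 * σ))),
      integral_Ioi_rpow_of_lt (by linarith) hN0, show -(2 * σ) + 1 = -(2 * σ - 1) by ring,
      neg_div_neg_eq]
  have hnn : ∀ t ∈ Ioi (0 : ℝ), 0 ≤ (t + N) ^ (-(2 * σ)) := fun t ht => by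
    have : (0 : ℝ) < t := ht
    positivity
  have h1 := hanti.tsum_add_one_le_integral hint hnn
  have h2 := hanti.summable_of_integrableOn_Ioi_zero hint hnn
  rw [hval] at h1
  refine ⟨?_, ?_⟩
  · simpa using (summable_nat_add_iff (f := fun n : ℕ => ((n : ℝ) + N) ^ (-(2 * σ))) 1).2 h2
  · simpa using h1

/-- Splitting a sum at frequency `N`: low frequencies are controlled by the sum of squares, high
frequencies by the weighted sum of squares. -/
theorem tsum_le_split {σ : ℝ} (hσ : 1 / 2 < σ) {X : ℕ → ℝ}
    (hA : Summable fun n => X n ^ 2) (hB : Summable fun n : ℕ => ((n : ℝ) + 1) ^ (2 * σ) * X n ^ 2)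
    (hX : ∀ n, 0 ≤ X n) {N : ℕ} (hN : 1 ≤ N) {α β : ℝ} (hα : 0 < α) (hβ : 0 < β) :
    Summable X ∧ ∑' n, X n ≤ α * ∑' n, X n ^ 2 + β * ∑' n : ℕ, ((n : ℝ) + 1) ^ (2 * σ) * X n ^ 2
      + (N / (4 * α) + (N : ℝ) ^ (-(2 * σ - 1)) / (2 * σ - 1) / (4 * β)) := by
  set e : ℕ → ℝ := fun n => if n < N then 1 / (4 * α) else ((n : ℝ) + 1) ^ (-(2 * σ)) / (4 * β)
    with he
  obtain ⟨ht1, ht2⟩ := tsum_rpow_tail_le hσ hN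
  have hshift : ∀ n : ℕ, e (n + N) = ((n : ℝ) + 1 + N) ^ (-(2 * σ)) / (4 * β) := by
    intro n
    simp only [he, show ¬ (n + N < N) by omega, if_false]
    push_cast
    ring_nf
  have hes : Summable e := by
    rw [← summable_nat_add_iff N]
    simp only [hshift]
    exact ht1.div_const _
  have hesum : ∑' n, e n ≤ N / (4 * α) + (N : ℝ) ^ (-(2 * σ - 1)) / (2 * σ - 1) / (4 * β) := by
    rw [← hes.sum_add_tsum_nat_add N]
    refine add_le_add (le_of_eq ?_) ?_
    · rw [Finset.sum_congr rfl fun n hn => if_pos (Finset.mem_range.1 hn), Finset.sum_const,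
        Finset.card_range, nsmul_eq_mul]
      ring
    · simp only [hshift]
      rw [tsum_div_const]
      gcongr
  have hpt : ∀ n, X n ≤ α * X n ^ 2 + β * (((n : ℝ) + 1) ^ (2 * σ) * X n ^ 2) + e n := by
    intro n
    have hw : (0 : ℝ) < ((n : ℝ) + 1) ^ (2 * σ) := by positivity
    -- the arithmetic-geometric mean inequality `z ≤ γ z² + 1 / (4 γ)`
    have amgm : ∀ γ : ℝ, 0 < γ → X n ≤ γ * X n ^ 2 + 1 / (4 * γ) := by
      intro γ hγ
      have h0 : γ * X n ^ 2 + 1 / (4 * γ) - X n = (2 * γ * X n - 1) ^ 2 / (4 * γ) := by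
        field_simp
        ring
      have h1 : 0 ≤ (2 * γ * X n - 1) ^ 2 / (4 * γ) := by positivity
      linarith
    by_cases hn : n < N
    · have := amgm α hα
      simp only [he, hn, if_true]
      have h2 : 0 ≤ β * (((n : ℝ) + 1) ^ (2 * σ) * X n ^ 2) := by positivity
      linarith
    · have := amgm (β * ((n : ℝ) + 1) ^ (2 * σ)) (by positivity)
      simp only [he, hn, if_false]
      have h2 : 0 ≤ α * X n ^ 2 := by positivity
      have h3 : ((n : ℝ) + 1) ^ (-(2 * σ)) / (4 * β) = 1 / (4 * (β * ((n : ℝ) + 1) ^ (2 * σ))) := by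
        rw [rpow_neg (by positivity)]
        field_simp
      rw [h3]
      linarith
  have hs := ((hA.mul_left α).add (hB.mul_left β)).add hes
  have hXs : Summable X := Summable.of_nonneg_of_le hX hpt hs
  refine ⟨hXs, (hXs.tsum_le_tsum hpt hs).trans ?_⟩
  rw [((hA.mul_left α).add (hB.mul_left β)).tsum_add hes, (hA.mul_left α).tsum_add (hB.mul_left β),
    tsum_mul_left, tsum_mul_left]
  linarith

/-- If a sum of nonnegative terms is at least `c`, then its sum of squares is bounded below by a
negative power of its weighted sum of squares: a multiplicative form of the one-dimensional Sobolev
embedding of `H^σ`, `σ > 1/2`, into continuous functions. -/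
theorem exists_interpolation {σ c : ℝ} (hσ : 1 / 2 < σ) (hc : 0 < c) :
    ∃ C : ℝ, 0 < C ∧ ∀ X : ℕ → ℝ, (∀ n, 0 ≤ X n) → (Summable fun n => X n ^ 2) →
      (Summable fun n : ℕ => ((n : ℝ) + 1) ^ (2 * σ) * X n ^ 2) → c ≤ ∑' n, X n →
      0 < ∑' n : ℕ, ((n : ℝ) + 1) ^ (2 * σ) * X n ^ 2 ∧
      (∑' n : ℕ, ((n : ℝ) + 1) ^ (2 * σ) * X n ^ 2) ^ (-(1 / (2 * σ - 1))) ≤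
        C * ∑' n, X n ^ 2 := by
  set ρ := 2 * σ - 1 with hρ
  have hρ0 : 0 < ρ := by linarith
  set D : ℝ := 2 + 1 / ρ with hD
  have hD0 : 0 < D := by positivity
  set κ : ℝ := c ^ 2 / (2 * D) with hκ
  have hκ0 : 0 < κ := by positivity
  refine ⟨4 / κ * (2 / κ) ^ (1 / ρ), by positivity, fun X hX hA hB hcX => ?_⟩
  set A := ∑' n, X n ^ 2 with hAdef
  set B := ∑' n : ℕ, ((n : ℝ) + 1) ^ (2 * σ) * X n ^ 2 with hBdef
  have hA0 : 0 ≤ A := tsum_nonneg fun n => sq_nonneg _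
  have hAB : A ≤ B := by
    refine hA.tsum_le_tsum (fun n => ?_) hB
    refine le_mul_of_one_le_left (sq_nonneg _) (one_le_rpow ?_ (by linarith))
    have : (0 : ℝ) ≤ n := n.cast_nonneg
    linarith
  -- the two parameters of the splitting are chosen to make the error terms equal to `c / 4`
  have split : ∀ N : ℕ, 1 ≤ N → κ ≤ N * A + (N : ℝ) ^ (-ρ) * B := by
    intro N hN
    have hN0 : (0 : ℝ) < N := by exact_mod_cast hN
    have hNρ : (0 : ℝ) < (N : ℝ) ^ (-ρ) := by positivity
    have h := (tsum_le_split hσ hA hB hX hN (α := N / c) (β := (N : ℝ) ^ (-ρ) / ρ / c)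
      (by positivity) (by positivity)).2
    rw [← hρ] at h
    have e1 : (N : ℝ) / (4 * (N / c)) = c / 4 := by field_simp
    have e2 : (N : ℝ) ^ (-ρ) / ρ / (4 * ((N : ℝ) ^ (-ρ) / ρ / c)) = c / 4 := by field_simp
    rw [e1, e2] at h
    have h1 : c / 2 ≤ N / c * A + (N : ℝ) ^ (-ρ) / ρ / c * B := by linarith
    have h2 : c ^ 2 / 2 ≤ N * A + 1 / ρ * ((N : ℝ) ^ (-ρ) * B) := by
      have := mul_le_mul_of_nonneg_left h1 hc.le
      calc c ^ 2 / 2 = c * (c / 2) := by ring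
        _ ≤ c * (N / c * A + (N : ℝ) ^ (-ρ) / ρ / c * B) := this
        _ = _ := by field_simp
    have h3 : 0 ≤ (N : ℝ) * A := by positivity
    have h4 : 0 ≤ (N : ℝ) ^ (-ρ) * B := mul_nonneg hNρ.le (hA0.trans hAB)
    have h5 : 0 < 1 / ρ := by positivity
    rw [hκ, div_le_iff₀ (by positivity)]
    rw [hD]
    nlinarith
  have hκB : κ ≤ 2 * B := by
    have := split 1 le_rfl
    simp only [Nat.cast_one, one_rpow, one_mul] at this
    linarith
  have hB0 : 0 < B := by linarith
  refine ⟨hB0, ?_⟩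
  set Y : ℝ := (2 * B / κ) ^ (1 / ρ) with hY
  have hY1 : 1 ≤ Y := one_le_rpow (by rw [le_div_iff₀ hκ0]; linarith) (by positivity)
  have hY0 : 0 < Y := by linarith
  have hYρ : Y ^ (-ρ) * B = κ / 2 := by
    rw [hY, ← rpow_mul (by positivity), show 1 / ρ * -ρ = -1 by field_simp, rpow_neg_one]
    field_simp
  have hN1 : 1 ≤ ⌈Y⌉₊ := Nat.one_le_iff_ne_zero.2 (Nat.ceil_pos.2 hY0).ne'
  have hNY : (⌈Y⌉₊ : ℝ) ≤ 2 * Y := by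
    have := Nat.ceil_lt_add_one hY0.le
    linarith
  have h1 := split ⌈Y⌉₊ hN1
  have h2 : ((⌈Y⌉₊ : ℝ)) ^ (-ρ) * B ≤ κ / 2 := by
    rw [← hYρ]
    exact mul_le_mul_of_nonneg_right
      (rpow_le_rpow_of_nonpos hY0 (Nat.le_ceil Y) (by linarith)) hB0.le
  have h3 : κ / 2 ≤ 2 * Y * A := by
    have := mul_le_mul_of_nonneg_right hNY hA0
    linarith
  have h4 : B ^ (-(1 / ρ)) = (2 / κ) ^ (1 / ρ) / Y := by
    rw [hY, show 2 * B / κ = 2 / κ * B by ring, mul_rpow (by positivity) hB0.le,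
      rpow_neg hB0.le]
    field_simp
  rw [h4, div_le_iff₀ hY0]
  have h5 : (0 : ℝ) < (2 / κ) ^ (1 / ρ) := by positivity
  have h6 : 1 ≤ 4 / κ * (A * Y) := by
    rw [div_mul_eq_mul_div, le_div_iff₀ hκ0]
    linarith
  calc (2 / κ) ^ (1 / ρ) = (2 / κ) ^ (1 / ρ) * 1 := (mul_one _).symm
    _ ≤ (2 / κ) ^ (1 / ρ) * (4 / κ * (A * Y)) := mul_le_mul_of_nonneg_left h6 h5.le
    _ = _ := by ring

/-! ### The lower bound for weighted sums of the first vertical mode -/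

/-- The sum `∑_{k ≠ 0} |k|^{2σ} |S k|²`, with values in `[0, ∞]`. -/
noncomputable def weightedSum (σ : ℝ) (S : ℤ → ℂ) : ENNReal :=
  ∑' k : {k : ℤ // k ≠ 0}, ENNReal.ofReal (|(k.1 : ℝ)| ^ (2 * σ) * ‖S k.1‖ ^ 2)

theorem summable_and_tsum_le_of_injective {ι : Type*} {f : ι → ℝ} (hf : ∀ i, 0 ≤ f i)
    (hfin : ∑' i, ENNReal.ofReal (f i) ≠ ⊤) {φ : ℕ → ι} (hφ : Function.Injective φ) :
    Summable (fun n => f (φ n)) ∧ ∑' n, f (φ n) ≤ (∑' i, ENNReal.ofReal (f i)).toReal := by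
  have hs : Summable f := by
    have := ENNReal.summable_toReal hfin
    simpa only [ENNReal.toReal_ofReal (hf _)] using this
  refine ⟨hs.comp_injective hφ, ?_⟩
  rw [← ENNReal.ofReal_tsum_of_nonneg hf hs, ENNReal.toReal_ofReal (tsum_nonneg hf)]
  exact (hs.comp_injective hφ).tsum_le_tsum_of_inj φ hφ (fun i _ => hf i) (fun _ => le_rfl) hs

/-- The interpolation inequality for two-sided sequences that sum to zero as soon as they are
summable, and whose zeroth term is not small. -/
theorem exists_interpolation_int {σ c : ℝ} (hσ : 1 / 2 < σ) (hc : 0 < c) :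
    ∃ C : ℝ, 0 < C ∧ ∀ S : ℤ → ℂ, (Summable S → HasSum S 0) → c ≤ ‖S 0‖ →
      weightedSum σ S ^ (-(1 / (2 * σ - 1))) ≤ ENNReal.ofReal C * weightedSum 0 S := by
  obtain ⟨C, hC, hint⟩ := exists_interpolation hσ hc
  have hρ0 : 0 < 2 * σ - 1 := by linarith
  set γ := 1 / (2 * σ - 1) with hγ
  have hγ0 : 0 < γ := by positivity
  refine ⟨4 ^ γ * (C * 4), by positivity, fun S hS hS0 => ?_⟩
  by_cases hA : weightedSum 0 S = ⊤
  · rw [hA, ENNReal.mul_top]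
    · exact le_top
    · exact (ENNReal.ofReal_pos.2 (by positivity)).ne'
  by_cases hB : weightedSum σ S = ⊤
  · rw [hB, ENNReal.top_rpow_of_neg (by linarith)]
    exact zero_le
  have inj1 : Function.Injective fun n : ℕ => (⟨(n : ℤ) + 1, by omega⟩ : {k : ℤ // k ≠ 0}) := by
    intro m n h
    simpa using h
  have inj2 : Function.Injective fun n : ℕ => (⟨-((n : ℤ) + 1), by omega⟩ : {k : ℤ // k ≠ 0}) := by
    intro m n h
    simpa using h
  have hf : ∀ τ : ℝ, ∀ k : {k : ℤ // k ≠ 0}, 0 ≤ |(k.1 : ℝ)| ^ (2 * τ) * ‖S k.1‖ ^ 2 :=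
    fun τ k => by positivity
  set X : ℕ → ℝ := fun n => ‖S ((n : ℤ) + 1)‖ + ‖S (-((n : ℤ) + 1))‖ with hX
  have hX2 : ∀ n, X n ^ 2 ≤ 2 * (‖S ((n : ℤ) + 1)‖ ^ 2 + ‖S (-((n : ℤ) + 1))‖ ^ 2) := fun n =>
    add_sq_le
  have habs : ∀ n : ℕ, |((n : ℝ) + 1)| = (n : ℝ) + 1 := fun n => abs_of_nonneg (by positivity)
  have weighted : ∀ τ : ℝ, weightedSum τ S ≠ ⊤ →
      Summable (fun n : ℕ => ((n : ℝ) + 1) ^ (2 * τ) * X n ^ 2) ∧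
      ∑' n : ℕ, ((n : ℝ) + 1) ^ (2 * τ) * X n ^ 2 ≤ 4 * (weightedSum τ S).toReal := by
    intro τ hτ
    obtain ⟨s1, l1⟩ := summable_and_tsum_le_of_injective (hf τ) hτ inj1
    obtain ⟨s2, l2⟩ := summable_and_tsum_le_of_injective (hf τ) hτ inj2
    simp only [Int.cast_add, Int.cast_neg, Int.cast_natCast, Int.cast_one, abs_neg, habs]
      at s1 s2 l1 l2
    have hpt : ∀ n : ℕ, ((n : ℝ) + 1) ^ (2 * τ) * X n ^ 2 ≤
        2 * (((n : ℝ) + 1) ^ (2 * τ) * ‖S ((n : ℤ) + 1)‖ ^ 2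
          + ((n : ℝ) + 1) ^ (2 * τ) * ‖S (-((n : ℤ) + 1))‖ ^ 2) := by
      intro n
      have := mul_le_mul_of_nonneg_left (hX2 n)
        (show (0 : ℝ) ≤ ((n : ℝ) + 1) ^ (2 * τ) by positivity)
      linarith
    have hs := (s1.add s2).mul_left 2
    have hsX := Summable.of_nonneg_of_le (fun n => by positivity) hpt hs
    refine ⟨hsX, (hsX.tsum_le_tsum hpt hs).trans ?_⟩
    rw [tsum_mul_left, s1.tsum_add s2]
    simp only [weightedSum] at l1 l2 ⊢
    linarith
  obtain ⟨sB, lB⟩ := weighted σ hB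
  obtain ⟨sA, lA⟩ := weighted 0 hA
  simp only [mul_zero, rpow_zero, one_mul] at sA lA
  have hX0 : ∀ n, 0 ≤ X n := fun n => by positivity
  have hXs : Summable X :=
    (tsum_le_split hσ sA sB hX0 le_rfl one_pos one_pos).1
  have n1 : Summable fun n : ℕ => ‖S ((n : ℤ) + 1)‖ :=
    Summable.of_nonneg_of_le (fun n => norm_nonneg _)
      (fun n => le_add_of_nonneg_right (norm_nonneg _)) hXs
  have n2 : Summable fun n : ℕ => ‖S (-((n : ℤ) + 1))‖ :=
    Summable.of_nonneg_of_le (fun n => norm_nonneg _)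
      (fun n => le_add_of_nonneg_left (norm_nonneg _)) hXs
  have hnat : Summable fun n : ℕ => S n := by
    rw [← summable_nat_add_iff 1]
    simpa using n1.of_norm
  have hneg : Summable fun n : ℕ => S (-((n : ℤ) + 1)) := n2.of_norm
  have hcX : c ≤ ∑' n, X n := by
    have h0 := (hS (Summable.of_nat_of_neg_add_one hnat hneg)).tsum_eq
    rw [tsum_of_nat_of_neg_add_one hnat hneg, hnat.tsum_eq_zero_add] at h0
    simp only [Nat.cast_add, Nat.cast_one, Nat.cast_zero] at h0
    have h1 : S 0 = -(∑' n : ℕ, S ((n : ℤ) + 1) + ∑' n : ℕ, S (-((n : ℤ) + 1))) := by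
      linear_combination h0
    calc c ≤ ‖S 0‖ := hS0
      _ ≤ ‖∑' n : ℕ, S ((n : ℤ) + 1)‖ + ‖∑' n : ℕ, S (-((n : ℤ) + 1))‖ := by
        rw [h1, norm_neg]
        exact norm_add_le _ _
      _ ≤ ∑' n : ℕ, ‖S ((n : ℤ) + 1)‖ + ∑' n : ℕ, ‖S (-((n : ℤ) + 1))‖ :=
        add_le_add (norm_tsum_le_tsum_norm n1) (norm_tsum_le_tsum_norm n2)
      _ = ∑' n, X n := (n1.tsum_add n2).symm
  obtain ⟨hpos, hfin⟩ := hint X hX0 sA sB hcX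
  set W := ∑' n : ℕ, ((n : ℝ) + 1) ^ (2 * σ) * X n ^ 2 with hW
  set A := (weightedSum 0 S).toReal with hAr
  set B := (weightedSum σ S).toReal with hBr
  have hB0 : 0 < B := by linarith
  have h1 : B ^ (-γ) ≤ 4 ^ γ * (C * 4) * A := by
    have e1 : B ^ (-γ) ≤ (W / 4) ^ (-γ) :=
      rpow_le_rpow_of_nonpos (by positivity) (by linarith) (by linarith)
    have e2 : (W / 4) ^ (-γ) = 4 ^ γ * W ^ (-γ) := by
      rw [div_rpow hpos.le (by norm_num), rpow_neg (by norm_num : (0 : ℝ) ≤ 4), div_inv_eq_mul,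
        mul_comm]
    have e3 : W ^ (-γ) ≤ C * (4 * A) := hfin.trans (mul_le_mul_of_nonneg_left lA hC.le)
    have e4 := mul_le_mul_of_nonneg_left e3 (show (0 : ℝ) ≤ 4 ^ γ by positivity)
    rw [e2] at e1
    linarith
  rw [← ENNReal.ofReal_toReal hA, ← ENNReal.ofReal_toReal hB, ← hAr, ← hBr,
    ENNReal.ofReal_rpow_of_pos hB0, ← ENNReal.ofReal_mul (by positivity)]
  exact ENNReal.ofReal_le_ofReal h1

/-- The coefficients of the density against `e^{-i k x₁} sin x₂` at time `t`. -/
noncomputable def sineMode (r : ℝ × ℝ × ℝ → ℝ) (t : ℝ) (k : ℤ) : ℂ :=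
  modeCoeff (fun b => (sin b : ℂ)) (fun x => r (t, x)) k

section

variable {ρ₀ : ℝ × ℝ → ℝ} {r u v p : ℝ × ℝ × ℝ → ℝ}

/-- The sine modes sum to zero, because the density vanishes for `x₁ = 0`. -/
theorem IsFlowFrom.hasSum_sineMode (h : IsFlowFrom ρ₀ r u v p) (h₀ : IsStripData ρ₀) {t : ℝ}
    (ht : 0 ≤ t) (hs : Summable (sineMode r t)) : HasSum (sineMode r t) 0 := by
  have hsin : Continuous fun b : ℝ => (sin b : ℂ) := by fun_prop
  have hr := continuousOn_slice h.smooth_r ht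
  have he : sineMode r t = fun k => _ := funext (modeCoeff_eq_integral hsin hr)
  rw [he] at hs ⊢
  have hp : Function.Periodic (vMoment (fun b => (sin b : ℂ)) fun x => r (t, x)) (2 * π) := by
    intro a
    refine setIntegral_congr_fun measurableSet_Icc fun b hb => ?_
    have := h.periodic t ht a b hb
    simp only at this
    simp only [this]
  have h0 : vMoment (fun b => (sin b : ℂ)) (fun x => r (t, x)) 0 = 0 :=
    setIntegral_eq_zero_of_forall_eq_zero fun b hb => by
      simp [h.zero_axis h₀ ht hb]
  have h1 := hasSum_fourier_of_summable (continuous_vMoment hsin hr) hp hs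
  rwa [h0, mul_zero] at h1

theorem sineMode_zero (r : ℝ × ℝ × ℝ → ℝ) (t : ℝ) :
    sineMode r t 0 = ((∫ x in cell, r (t, x) * sin x.2 : ℝ) : ℂ) := by
  rw [sineMode, modeCoeff]
  refine Eq.trans ?_ integral_ofReal
  congr 1
  ext x
  simp [mul_comm]

/-- The nonzero sine modes of the density are controlled by the kinetic energy. -/
theorem IsFlowFrom.weightedSum_zero_le (h : IsFlowFrom ρ₀ r u v p) {t : ℝ} (ht : 0 < t) :
    weightedSum 0 (sineMode r t) ≤
      ENNReal.ofReal (2 * (2 * π) ^ 2 * ∫ x in cell, (u (t, x) ^ 2 + v (t, x) ^ 2)) := by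
  have hsin : Continuous fun b : ℝ => (sin b : ℂ) := by fun_prop
  have hcos : Continuous fun b : ℝ => (cos b : ℂ) := by fun_prop
  have hr := continuousOn_slice h.smooth_r ht.le
  have hu := continuousOn_slice h.smooth_u ht.le
  have hv := continuousOn_slice h.smooth_v ht.le
  have hp := continuousOn_slice h.smooth_p ht.le
  have hint : ∀ x ∈ interior strip, (t, x) ∈ interior spaceTime := by
    intro x hx
    rw [interior_strip] at hx
    rw [interior_spaceTime]
    exact ⟨ht, hx⟩
  have darcy := darcy_modeCoeff hp hu hv hr (fun x hx => by
      have hq := hint x hx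
      refine ⟨(fderiv ℝ p (t, x)).comp (ContinuousLinearMap.inr ℝ ℝ (ℝ × ℝ)),
        (hasFDerivAt_of_interior h.smooth_p hq).comp x (hasFDerivAt_prodMk_right t x), ?_, ?_⟩
      · have := h.darcy1 _ hq
        rw [dX] at this
        simp only [ContinuousLinearMap.comp_apply, ContinuousLinearMap.inr_apply]
        linarith
      · have := h.darcy2 _ hq
        rw [dY] at this
        simp only [ContinuousLinearMap.comp_apply, ContinuousLinearMap.inr_apply]
        linarith) (fun b hb => h.periodic_p t ht.le b hb)
  set U : ℤ → ℂ := modeCoeff (fun b => (cos b : ℂ)) (fun x => u (t, x)) with hU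
  set V : ℤ → ℂ := modeCoeff (fun b => (sin b : ℂ)) (fun x => v (t, x)) with hV
  have hpt : ∀ k : {k : ℤ // k ≠ 0}, |(k.1 : ℝ)| ^ (2 * (0 : ℝ)) * ‖sineMode r t k.1‖ ^ 2 ≤
      2 * (‖U k.1‖ ^ 2 + ‖V k.1‖ ^ 2) := by
    rintro ⟨k, hk⟩
    have h0 : U k + Complex.I * k * (V k + sineMode r t k) = 0 := darcy k
    have h1 : Complex.I * k * (V k + sineMode r t k) = -U k := by
      linear_combination h0
    have h2 : ‖V k + sineMode r t k‖ ≤ ‖U k‖ := by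
      have hk1 : (1 : ℝ) ≤ ‖(k : ℂ)‖ := by
        rw [Complex.norm_intCast]
        exact_mod_cast Int.one_le_abs hk
      have := congrArg norm h1
      rw [norm_mul, norm_mul, Complex.norm_I, one_mul, norm_neg] at this
      rw [← this]
      exact le_mul_of_one_le_left (norm_nonneg _) hk1
    have h3 : ‖sineMode r t k‖ ≤ ‖U k‖ + ‖V k‖ := by
      have : sineMode r t k = (V k + sineMode r t k) - V k := by ring
      rw [this]
      exact (norm_sub_le _ _).trans (add_le_add_left h2 _)
    simp only [mul_zero, rpow_zero, one_mul]
    exact (pow_le_pow_left₀ (norm_nonneg _) h3 2).trans add_sq_le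
  have hb1 : ∀ b : ℝ, ‖(cos b : ℂ)‖ ≤ 1 := fun b => by
    rw [Complex.norm_real]
    exact abs_cos_le_one b
  have hb2 : ∀ b : ℝ, ‖(sin b : ℂ)‖ ≤ 1 := fun b => by
    rw [Complex.norm_real]
    exact abs_sin_le_one b
  have i1 : IntegrableOn (fun x => u (t, x) ^ 2) cell :=
    ((hu.mono cell_subset_strip).pow 2).integrableOn_compact isCompact_cell
  have i2 : IntegrableOn (fun x => v (t, x) ^ 2) cell :=
    ((hv.mono cell_subset_strip).pow 2).integrableOn_compact isCompact_cell
  have n1 : 0 ≤ ∫ x in cell, u (t, x) ^ 2 := integral_nonneg fun x => sq_nonneg _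
  have n2 : 0 ≤ ∫ x in cell, v (t, x) ^ 2 := integral_nonneg fun x => sq_nonneg _
  calc weightedSum 0 (sineMode r t)
      ≤ ∑' k : {k : ℤ // k ≠ 0}, ENNReal.ofReal (2 * (‖U k.1‖ ^ 2 + ‖V k.1‖ ^ 2)) :=
        ENNReal.tsum_le_tsum fun k => ENNReal.ofReal_le_ofReal (hpt k)
    _ ≤ ∑' k : ℤ, ENNReal.ofReal (2 * (‖U k‖ ^ 2 + ‖V k‖ ^ 2)) :=
        ENNReal.tsum_comp_le_tsum_of_injective Subtype.val_injective
          (fun k : ℤ => ENNReal.ofReal (2 * (‖U k‖ ^ 2 + ‖V k‖ ^ 2)))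
    _ = ENNReal.ofReal 2 * (∑' k : ℤ, ENNReal.ofReal (‖U k‖ ^ 2)
          + ∑' k : ℤ, ENNReal.ofReal (‖V k‖ ^ 2)) := by
        rw [← ENNReal.tsum_add, ← ENNReal.tsum_mul_left]
        congr 1
        ext k
        rw [ENNReal.ofReal_mul (by norm_num), ENNReal.ofReal_add (by positivity) (by positivity)]
    _ ≤ ENNReal.ofReal 2 * (ENNReal.ofReal ((2 * π) ^ 2 * ∫ x in cell, u (t, x) ^ 2)
          + ENNReal.ofReal ((2 * π) ^ 2 * ∫ x in cell, v (t, x) ^ 2)) := by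
        gcongr
        · exact tsum_sq_modeCoeff_le hcos hb1 hu
        · exact tsum_sq_modeCoeff_le hsin hb2 hv
    _ = _ := by
        rw [← ENNReal.ofReal_add (by positivity) (by positivity),
          ← ENNReal.ofReal_mul (by norm_num), integral_add i1 i2]
        congr 1
        ring

/-- High regularity of the first sine mode forces kinetic energy. -/
theorem IsStripData.exists_weightedSum_rpow_le (h₀ : IsStripData ρ₀) {σ : ℝ} (hσ : 1 / 2 < σ) :
    ∃ C : ℝ, 0 < C ∧ ∀ r u v p : ℝ × ℝ × ℝ → ℝ, IsFlowFrom ρ₀ r u v p → ∀ t, 0 < t →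
      weightedSum σ (sineMode r t) ^ (-(1 / (2 * σ - 1))) ≤
        ENNReal.ofReal C * ENNReal.ofReal (∫ x in cell, (u (t, x) ^ 2 + v (t, x) ^ 2)) := by
  obtain ⟨c, hc, hmom⟩ := h₀.exists_moment_lower_bound
  obtain ⟨C, hC, hint⟩ := exists_interpolation_int hσ hc
  refine ⟨C * (2 * (2 * π) ^ 2), by positivity, fun r u v p h t ht => ?_⟩
  have h1 := hint (sineMode r t) (h.hasSum_sineMode h₀ ht.le) (by
    rw [sineMode_zero, Complex.norm_real]
    exact (hmom r u v p h t ht.le).trans (le_abs_self _))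
  refine h1.trans ?_
  rw [ENNReal.ofReal_mul hC.le, mul_assoc, ← ENNReal.ofReal_mul (by positivity)]
  gcongr
  exact h.weightedSum_zero_le ht

/-- The total kinetic energy is finite. -/
theorem IsFlowFrom.lintegral_velocity_le (h : IsFlowFrom ρ₀ r u v p) (h₀ : IsStripData ρ₀) :
    ∫⁻ t in Ioi (0 : ℝ), ENNReal.ofReal (∫ x in cell, (u (t, x) ^ 2 + v (t, x) ^ 2)) ≤
      ENNReal.ofReal (∫ x in cell, ρ₀ x * x.2) := by
  have hU : Ioi (0 : ℝ) = ⋃ n : ℕ, Icc 0 ((n : ℝ) + 1) ∩ Ioi 0 := by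
    ext t
    simp only [mem_Ioi, mem_iUnion, mem_inter_iff, mem_Icc]
    constructor
    · intro ht
      obtain ⟨n, hn⟩ := exists_nat_ge t
      exact ⟨n, ⟨ht.le, by linarith⟩, ht⟩
    · rintro ⟨n, -, ht⟩
      exact ht
  have hdir : Directed (· ⊆ ·) fun n : ℕ => Icc 0 ((n : ℝ) + 1) ∩ Ioi 0 := by
    refine Monotone.directed_le fun m n hmn => ?_
    refine inter_subset_inter_left _ (Icc_subset_Icc_right ?_)
    have : (m : ℝ) ≤ n := by exact_mod_cast hmn
    linarith
  rw [hU, setLIntegral_iUnion_of_directed _ hdir]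
  refine iSup_le fun n => (lintegral_mono_set inter_subset_left).trans ?_
  obtain ⟨hi, hle⟩ := h.integral_velocity_le h₀ (T := (n : ℝ) + 1) (by positivity)
  have e : ∫ q in box ((n : ℝ) + 1) (-π) π (-π) π, (u q ^ 2 + v q ^ 2)
      = ∫ t in Icc 0 ((n : ℝ) + 1), ∫ x in cell, (u (t, x) ^ 2 + v (t, x) ^ 2) :=
    setIntegral_prod (μ := volume) (ν := volume) _ hi
  have hi' : IntegrableOn (fun t => ∫ x in cell, (u (t, x) ^ 2 + v (t, x) ^ 2))
      (Icc 0 ((n : ℝ) + 1)) := by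
    have h1 : Integrable (fun q => u q ^ 2 + v q ^ 2)
        ((volume.restrict (Icc 0 ((n : ℝ) + 1))).prod (volume.restrict cell)) := by
      rw [Measure.prod_restrict]
      exact hi
    exact h1.integral_prod_left
  rw [← ofReal_integral_eq_lintegral_ofReal hi'
    (ae_of_all _ fun t => integral_nonneg fun x => by positivity), ← e]
  exact ENNReal.ofReal_le_ofReal hle

/-- A quantity with integrable power `-2 / (2 s + 1)` cannot be bounded by `t ^ (s + 1 / 2)`. -/
theorem limsup_eq_top_of_lintegral_lt_top {s : ℝ} (hs : -(1 / 2) < s) {N : ℝ → ENNReal}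
    (hN : ∫⁻ t in Ioi (0 : ℝ), N t ^ (-(2 / (2 * s + 1))) < ⊤) :
    limsup (fun t : ℝ => ENNReal.ofReal (t ^ (-(s + 1 / 2))) * N t) atTop = ⊤ := by
  by_contra hne
  obtain ⟨K, hK, -⟩ := ENNReal.lt_iff_exists_nnreal_btwn.1 (lt_top_iff_ne_top.2 hne)
  have hev := eventually_lt_of_limsup_lt hK
  obtain ⟨t₀, ht₀⟩ := eventually_atTop.1 hev
  set γ := 2 / (2 * s + 1) with hγ
  have h2s : 0 < 2 * s + 1 := by linarith
  have hγ0 : 0 < γ := by positivity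
  set M : ℝ := K + 1 with hM
  have hM0 : 0 < M := by positivity
  set T := max t₀ 1 with hT
  have hpt : ∀ t ∈ Ioi T, ENNReal.ofReal (M ^ (-γ) * t⁻¹) ≤ N t ^ (-γ) := by
    intro t ht
    have ht' : T < t := ht
    have ht1 : 0 < t := zero_lt_one.trans ((le_max_right t₀ 1).trans_lt ht')
    have h1 := ht₀ t ((le_max_left t₀ 1).trans ht'.le)
    have h2 : N t ≤ ENNReal.ofReal (M * t ^ (s + 1 / 2)) := by
      have e1 : ENNReal.ofReal (t ^ (s + 1 / 2)) * ENNReal.ofReal (t ^ (-(s + 1 / 2))) = 1 := by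
        rw [← ENNReal.ofReal_mul (by positivity), ← rpow_add ht1, add_neg_cancel, rpow_zero,
          ENNReal.ofReal_one]
      calc N t = ENNReal.ofReal (t ^ (s + 1 / 2)) *
            (ENNReal.ofReal (t ^ (-(s + 1 / 2))) * N t) := by
            rw [← mul_assoc, e1, one_mul]
        _ ≤ ENNReal.ofReal (t ^ (s + 1 / 2)) * ENNReal.ofReal M := by
            gcongr
            refine h1.le.trans ?_
            rw [← ENNReal.ofReal_coe_nnreal]
            exact ENNReal.ofReal_le_ofReal (by linarith)
        _ = _ := by rw [← ENNReal.ofReal_mul (by positivity), mul_comm]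
    have h3 : ENNReal.ofReal (M ^ (-γ) * t⁻¹) = ENNReal.ofReal (M * t ^ (s + 1 / 2)) ^ (-γ) := by
      rw [ENNReal.ofReal_rpow_of_pos (by positivity), mul_rpow hM0.le (by positivity),
        ← rpow_mul ht1.le, show (s + 1 / 2) * -γ = -1 by
          rw [hγ, show s + 1 / 2 = (2 * s + 1) / 2 by ring]; field_simp, rpow_neg_one]
    rw [h3, ENNReal.rpow_neg, ENNReal.rpow_neg, ENNReal.inv_le_inv]
    exact ENNReal.rpow_le_rpow h2 hγ0.le
  have hfin : ∫⁻ t in Ioi T, ENNReal.ofReal (M ^ (-γ) * t⁻¹) < ⊤ :=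
    ((setLIntegral_mono' measurableSet_Ioi hpt).trans (lintegral_mono_set
      (Ioi_subset_Ioi (zero_le_one.trans (le_max_right t₀ 1))))).trans_lt hN
  have hint : IntegrableOn (fun t : ℝ => M ^ (-γ) * t⁻¹) (Ioi T) := by
    refine (lintegral_ofReal_ne_top_iff_integrable ?_ ?_).1 hfin.ne
    · exact Measurable.aestronglyMeasurable (by fun_prop)
    · refine (ae_restrict_iff' measurableSet_Ioi).2 (ae_of_all _ fun t ht => ?_)
      have ht1 : 0 < t := zero_lt_one.trans ((le_max_right t₀ 1).trans_lt ht)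
      simp only [Pi.zero_apply]
      positivity
  have hMγ : M ^ (-γ) ≠ 0 := (rpow_pos_of_pos hM0 _).ne'
  refine not_integrableOn_Ioi_inv (a := T) ((hint.const_mul (M ^ (-γ))⁻¹).congr ?_)
  exact ae_of_all _ fun t => by
    simp only
    rw [inv_mul_cancel_left₀ hMγ]

/-- The growth statement for any norm that controls the weighted sum over the first sine mode. -/
theorem IsStripData.exists_growth_bound (h₀ : IsStripData ρ₀) {s : ℝ} (hs : -(1 / 2) < s) {C₁ : ℝ}
    (hC₁ : 0 < C₁) :
    ∃ C : NNReal, ∀ (r u v p : ℝ × ℝ × ℝ → ℝ) (N : ℝ → ENNReal), IsFlowFrom ρ₀ r u v p →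
      (∀ t, 0 < t → weightedSum (s + 1) (sineMode r t) ≤ ENNReal.ofReal C₁ * N t ^ (2 : ℝ)) →
      (∫⁻ t in Ioi (0 : ℝ), N t ^ (-(2 / (2 * s + 1)))) ≤ (C : ENNReal) ∧
      limsup (fun t : ℝ => ENNReal.ofReal (t ^ (-(s + 1 / 2))) * N t) atTop = ⊤ := by
  obtain ⟨C, hC, hbound⟩ := h₀.exists_weightedSum_rpow_le (σ := s + 1) (by linarith)
  have h2s : 0 < 2 * s + 1 := by linarith
  set γ := 1 / (2 * s + 1) with hγ
  have hγ0 : 0 < γ := by positivity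
  rw [show 2 * (s + 1) - 1 = 2 * s + 1 by ring, ← hγ] at hbound
  set K : ℝ := C₁ ^ γ * C with hK
  have hK0 : 0 < K := by positivity
  refine ⟨(ENNReal.ofReal K * ENNReal.ofReal (∫ x in cell, ρ₀ x * x.2)).toNNReal,
    fun r u v p N h hN => ?_⟩
  rw [ENNReal.coe_toNNReal (ENNReal.mul_ne_top ENNReal.ofReal_ne_top ENNReal.ofReal_ne_top)]
  have hpt : ∀ t ∈ Ioi (0 : ℝ), N t ^ (-(2 / (2 * s + 1))) ≤
      ENNReal.ofReal K * ENNReal.ofReal (∫ x in cell, (u (t, x) ^ 2 + v (t, x) ^ 2)) := by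
    intro t ht
    have hc0 : ENNReal.ofReal C₁ ^ γ ≠ 0 := by
      rw [ENNReal.ofReal_rpow_of_pos hC₁]
      exact (ENNReal.ofReal_pos.2 (by positivity)).ne'
    have hct : ENNReal.ofReal C₁ ^ γ ≠ ⊤ := by
      rw [ENNReal.ofReal_rpow_of_pos hC₁]
      exact ENNReal.ofReal_ne_top
    have e1 : (ENNReal.ofReal C₁ * N t ^ (2 : ℝ)) ^ (-γ) ≤
        weightedSum (s + 1) (sineMode r t) ^ (-γ) := by
      rw [ENNReal.rpow_neg, ENNReal.rpow_neg, ENNReal.inv_le_inv]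
      exact ENNReal.rpow_le_rpow (hN t ht) hγ0.le
    have e2 : N t ^ (-(2 / (2 * s + 1))) =
        ENNReal.ofReal C₁ ^ γ * (ENNReal.ofReal C₁ * N t ^ (2 : ℝ)) ^ (-γ) := by
      rw [ENNReal.rpow_neg (ENNReal.ofReal C₁ * N t ^ (2 : ℝ)),
        ENNReal.mul_rpow_of_nonneg _ _ hγ0.le,
        ENNReal.mul_inv (Or.inl hc0) (Or.inl hct), ← mul_assoc, ENNReal.mul_inv_cancel hc0 hct,
        one_mul, ← ENNReal.rpow_mul, ← ENNReal.rpow_neg, hγ]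
      congr 1
      ring
    calc N t ^ (-(2 / (2 * s + 1)))
        ≤ ENNReal.ofReal C₁ ^ γ * (ENNReal.ofReal C *
            ENNReal.ofReal (∫ x in cell, (u (t, x) ^ 2 + v (t, x) ^ 2))) := by
          rw [e2]
          gcongr
          exact e1.trans (hbound r u v p h t ht)
      _ = _ := by
          rw [ENNReal.ofReal_rpow_of_pos hC₁, ← mul_assoc, ← ENNReal.ofReal_mul (by positivity)]
  have hle : ∫⁻ t in Ioi (0 : ℝ), N t ^ (-(2 / (2 * s + 1))) ≤
      ENNReal.ofReal K * ENNReal.ofReal (∫ x in cell, ρ₀ x * x.2) := by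
    refine (setLIntegral_mono' measurableSet_Ioi hpt).trans ?_
    rw [lintegral_const_mul' _ _ ENNReal.ofReal_ne_top]
    gcongr
    exact h.lintegral_velocity_le h₀
  exact ⟨hle, limsup_eq_top_of_lintegral_lt_top hs (hle.trans_lt
    (ENNReal.mul_lt_top ENNReal.ofReal_lt_top ENNReal.ofReal_lt_top))⟩

end

/-! ### The Sobolev norms -/

theorem stripCoeff_eq (f : ℝ × ℝ → ℝ) (m : ℤ) (q : ℕ) :
    stripCoeff f m q = modeCoeff (fun b => (stripB q b : ℂ)) f m :=
  setIntegral_congr_set (Measure.set_prod_ae_eq Ico_ae_eq_Icc Filter.EventuallyEq.rfl)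

theorem torusFourierCoeff_eq (f : ℝ × ℝ → ℝ) (k : ℤ × ℤ) :
    torusFourierCoeff f k = ((2 * π) ^ 2 : ℂ)⁻¹ *
      modeCoeff (fun b => Complex.exp (-(Complex.I * ((k.2 : ℂ) * (b : ℂ))))) f k.1 := by
  rw [torusFourierCoeff, modeCoeff]
  congr 1
  refine (setIntegral_congr_set (Measure.set_prod_ae_eq Ico_ae_eq_Icc Ico_ae_eq_Icc)).trans ?_
  refine setIntegral_congr_fun isCompact_cell.measurableSet fun x _ => ?_
  simp only [← Complex.exp_add]
  congr 2
  ring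

theorem stripB_two (b : ℝ) : stripB 2 b = sin b := by
  simp [stripB]

theorem differentiable_stripB (q : ℕ) : Differentiable ℝ fun b => (stripB q b : ℂ) := by
  unfold stripB
  split_ifs <;> fun_prop

theorem differentiable_sin_ofReal : Differentiable ℝ fun b : ℝ => (sin b : ℂ) := by
  fun_prop

theorem sq_rpow_half (x : ENNReal) : (x ^ (1 / 2 : ℝ)) ^ (2 : ℝ) = x := by
  rw [← ENNReal.rpow_mul]
  norm_num

theorem norm_I_mul_intCast_mul_sq (k : ℤ) (z : ℂ) :
    ‖Complex.I * k * z‖ ^ 2 = (k : ℝ) ^ 2 * ‖z‖ ^ 2 := by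
  rw [norm_mul, norm_mul, Complex.norm_I, one_mul, Complex.norm_intCast, mul_pow, sq_abs]

section

variable {g : ℝ × ℝ → ℝ}

/-- Differentiation in `x₁` costs at most one derivative, on the strip. -/
theorem stripHNorm_partial1_le (hg : ContDiffOn ℝ 1 g strip) (hp : StripPeriodic g) (s : ℝ) :
    stripHNorm s (partial1 g) ≤ stripHNorm (s + 1) g := by
  refine ENNReal.rpow_le_rpow (ENNReal.tsum_le_tsum fun k => ENNReal.ofReal_le_ofReal ?_)
    (by norm_num)
  rw [stripCoeff_eq, stripCoeff_eq, modeCoeff_partial1 (differentiable_stripB _) hg hp,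
    norm_I_mul_intCast_mul_sq]
  have hq : (0 : ℝ) < ((k.2 : ℕ) : ℝ) := by exact_mod_cast k.2.pos
  have hw : 0 < (k.1 : ℝ) ^ 2 + ((k.2 : ℕ) : ℝ) ^ 2 / 4 := by positivity
  rw [rpow_add_one hw.ne', mul_assoc]
  refine mul_le_mul_of_nonneg_left ?_ (by positivity)
  rw [mul_div_assoc]
  refine mul_le_mul_of_nonneg_right ?_ (by positivity)
  have : 0 ≤ ((k.2 : ℕ) : ℝ) ^ 2 / 4 := by positivity
  linarith

theorem differentiable_exp_mode (n : ℤ) :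
    Differentiable ℝ fun b : ℝ => Complex.exp (-(Complex.I * ((n : ℂ) * (b : ℂ)))) := by
  fun_prop

/-- Differentiation in `x₁` costs at most one derivative, on the torus. -/
theorem torusHNorm_partial1_le (hg : ContDiffOn ℝ 1 g strip) (hp : StripPeriodic g) (s : ℝ) :
    torusHNorm s (partial1 g) ≤ torusHNorm (s + 1) g := by
  refine ENNReal.rpow_le_rpow (mul_le_mul_right (ENNReal.tsum_le_tsum fun k =>
    ENNReal.ofReal_le_ofReal ?_) _) (by norm_num)
  obtain ⟨⟨m, n⟩, hk⟩ := k
  have hw : 0 < (m : ℝ) ^ 2 + (n : ℝ) ^ 2 := by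
    rcases eq_or_ne m 0 with rfl | hm
    · have hn : (n : ℝ) ≠ 0 := by
        rintro h0
        exact hk (by simp_all)
      positivity
    · have hm : (m : ℝ) ≠ 0 := by exact_mod_cast hm
      positivity
  simp only
  rw [torusFourierCoeff_eq, torusFourierCoeff_eq,
    modeCoeff_partial1 (differentiable_exp_mode _) hg hp, mul_left_comm, norm_I_mul_intCast_mul_sq,
    rpow_add_one hw.ne', mul_assoc]
  refine mul_le_mul_of_nonneg_left (mul_le_mul_of_nonneg_right ?_ (by positivity)) (by positivity)
  have : 0 ≤ (n : ℝ) ^ 2 := by positivity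
  linarith

theorem rpow_le_max_mul_add_one_rpow {s x : ℝ} (hx : 1 ≤ x) :
    x ^ s ≤ max 1 (2 ^ (-s)) * (x + 1) ^ s := by
  have hx0 : 0 < x := by linarith
  rcases le_total 0 s with hs | hs
  · calc x ^ s ≤ (x + 1) ^ s := rpow_le_rpow hx0.le (by linarith) hs
      _ ≤ _ := le_mul_of_one_le_left (by positivity) (le_max_left _ _)
  · have h1 : (2 * x) ^ s ≤ (x + 1) ^ s :=
      rpow_le_rpow_of_nonpos (by linarith) (by linarith) hs
    calc x ^ s = 2 ^ (-s) * (2 * x) ^ s := by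
          rw [mul_rpow (by norm_num) hx0.le, ← mul_assoc, ← rpow_add (by norm_num), neg_add_cancel,
            rpow_zero, one_mul]
      _ ≤ _ := mul_le_mul (le_max_right _ _) h1 (by positivity) (by positivity)

/-- The weighted sum over the first sine mode is controlled by the part of `‖∂₁g‖²` in `Ḣˢ` that
lives on this mode. -/
theorem weightedSum_le (hg : ContDiffOn ℝ 1 g strip) (hp : StripPeriodic g) (s : ℝ) :
    weightedSum (s + 1) (modeCoeff (fun b => (sin b : ℂ)) g) ≤
      ENNReal.ofReal (max 1 (2 ^ (-s))) * ∑' k : {k : ℤ // k ≠ 0},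
        ENNReal.ofReal (((k.1 : ℝ) ^ 2 + 1) ^ s *
          ‖modeCoeff (fun b => (sin b : ℂ)) (partial1 g) k.1‖ ^ 2) := by
  rw [← ENNReal.tsum_mul_left]
  refine ENNReal.tsum_le_tsum fun k => ?_
  rw [← ENNReal.ofReal_mul (by positivity)]
  refine ENNReal.ofReal_le_ofReal ?_
  obtain ⟨k, hk⟩ := k
  have hk2 : (1 : ℝ) ≤ (k : ℝ) ^ 2 := by
    rw [one_le_sq_iff_one_le_abs]
    exact_mod_cast Int.one_le_abs hk
  simp only
  rw [modeCoeff_partial1 differentiable_sin_ofReal hg hp, norm_I_mul_intCast_mul_sq,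
    rpow_mul (abs_nonneg _), rpow_two, sq_abs, rpow_add_one (by positivity)]
  have := mul_le_mul_of_nonneg_right (rpow_le_max_mul_add_one_rpow (s := s) hk2)
    (show 0 ≤ (k : ℝ) ^ 2 * ‖modeCoeff (fun b => (sin b : ℂ)) g k‖ ^ 2 by positivity)
  linarith

/-- The mode `sin x₂` is the vertical factor `b_q` with `q = 2`. -/
theorem weightedSum_le_stripHNorm (hg : ContDiffOn ℝ 1 g strip) (hp : StripPeriodic g) (s : ℝ) :
    weightedSum (s + 1) (modeCoeff (fun b => (sin b : ℂ)) g) ≤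
      ENNReal.ofReal (max 1 (2 ^ (-s)) * (2 * π ^ 2)) * stripHNorm s (partial1 g) ^ (2 : ℝ) := by
  refine (weightedSum_le hg hp s).trans ?_
  rw [ENNReal.ofReal_mul (by positivity), mul_assoc, stripHNorm, sq_rpow_half]
  gcongr
  have hinj : Function.Injective fun k : {k : ℤ // k ≠ 0} => ((k.1, 2) : ℤ × ℕ+) := by
    intro a b h
    exact Subtype.ext (congrArg Prod.fst h)
  refine le_trans (le_of_eq ?_) (mul_le_mul_right (ENNReal.tsum_comp_le_tsum_of_injective hinj
    (fun k : ℤ × ℕ+ => ENNReal.ofReal (((k.1 : ℝ) ^ 2 + ((k.2 : ℕ) : ℝ) ^ 2 / 4) ^ s *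
        (‖stripCoeff (partial1 g) k.1 (k.2 : ℕ)‖ ^ 2 / (2 * π ^ 2))))) _)
  rw [← ENNReal.tsum_mul_left]
  congr 1
  ext k
  rw [← ENNReal.ofReal_mul (by positivity), stripCoeff_eq]
  have h2 : (((2 : ℕ+) : ℕ) : ℝ) = 2 := by norm_num
  have h3 : ((2 : ℕ+) : ℕ) = 2 := rfl
  rw [h2, h3]
  simp only [stripB_two]
  have hπ := pi_pos.ne'
  congr 1
  rw [show (2 : ℝ) ^ 2 / 4 = 1 by norm_num]
  field_simp

/-- The sine mode is a combination of the Fourier modes `k₂ = 1` and `k₂ = -1`. -/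
theorem sq_norm_modeCoeff_sin_le (hg : ContDiffOn ℝ 1 g strip) (hp : StripPeriodic g) (k : ℤ) :
    ‖modeCoeff (fun b => (sin b : ℂ)) (partial1 g) k‖ ^ 2 ≤ (2 * π) ^ 4 / 2 *
      (‖torusFourierCoeff (partial1 g) (k, 1)‖ ^ 2
        + ‖torusFourierCoeff (partial1 g) (k, -1)‖ ^ 2) := by
  have hc : ∀ n : ℤ, IntegrableOn (fun x : ℝ × ℝ =>
      Complex.exp (-(Complex.I * ((k : ℂ) * (x.1 : ℂ)))) *
        Complex.exp (-(Complex.I * ((n : ℂ) * (x.2 : ℂ)))) * (g x : ℂ)) cell := fun n =>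
    (continuousOn_mode (differentiable_exp_mode n).continuous
      (hg.continuousOn.mono cell_subset_strip) k).integrableOn_compact isCompact_cell
  have hlin : modeCoeff (fun b => (sin b : ℂ)) g k = Complex.I / 2 *
      (modeCoeff (fun b => Complex.exp (-(Complex.I * (((1 : ℤ) : ℂ) * (b : ℂ))))) g k
        - modeCoeff (fun b => Complex.exp (-(Complex.I * (((-1 : ℤ) : ℂ) * (b : ℂ))))) g k) := by
    simp only [modeCoeff]
    rw [← integral_sub (hc 1) (hc (-1)), ← integral_const_mul]
    congr 1
    ext x
    rw [Complex.ofReal_sin, Complex.sin]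
    push_cast
    rw [show -(Complex.I * (1 * (x.2 : ℂ))) = -x.2 * Complex.I by ring,
      show -(Complex.I * (-1 * (x.2 : ℂ))) = x.2 * Complex.I by ring]
    ring
  have hπ : ((2 * π) ^ 2 : ℂ) ≠ 0 := by
    have : (π : ℂ) ≠ 0 := by exact_mod_cast pi_pos.ne'
    exact pow_ne_zero _ (mul_ne_zero two_ne_zero this)
  have h1 : modeCoeff (fun b => (sin b : ℂ)) (partial1 g) k = Complex.I / 2 * (2 * π) ^ 2 *
      (torusFourierCoeff (partial1 g) (k, 1) - torusFourierCoeff (partial1 g) (k, -1)) := by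
    rw [torusFourierCoeff_eq, torusFourierCoeff_eq,
      modeCoeff_partial1 (differentiable_exp_mode _) hg hp,
      modeCoeff_partial1 (differentiable_exp_mode _) hg hp,
      modeCoeff_partial1 differentiable_sin_ofReal hg hp, hlin]
    field_simp
  have hn : ‖Complex.I / 2 * (2 * (π : ℂ)) ^ 2‖ = (2 * π) ^ 2 / 2 := by
    rw [norm_mul, norm_div, Complex.norm_I, norm_pow, norm_mul, Complex.norm_real,
      norm_of_nonneg pi_pos.le]
    norm_num
    ring
  rw [h1, norm_mul, hn, mul_pow]
  have h2 := pow_le_pow_left₀ (norm_nonneg _) (norm_sub_le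
    (torusFourierCoeff (partial1 g) (k, 1)) (torusFourierCoeff (partial1 g) (k, -1))) 2
  have h3 := h2.trans add_sq_le
  have h4 := mul_le_mul_of_nonneg_left h3 (show 0 ≤ ((2 * π) ^ 2 / 2) ^ 2 by positivity)
  refine h4.trans (le_of_eq ?_)
  ring

theorem weightedSum_le_torusHNorm (hg : ContDiffOn ℝ 1 g strip) (hp : StripPeriodic g) (s : ℝ) :
    weightedSum (s + 1) (modeCoeff (fun b => (sin b : ℂ)) g) ≤
      ENNReal.ofReal (max 1 (2 ^ (-s)) * (2 * π) ^ 2) * torusHNorm s (partial1 g) ^ (2 : ℝ) := by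
  refine (weightedSum_le hg hp s).trans ?_
  rw [ENNReal.ofReal_mul (by positivity), mul_assoc, torusHNorm, sq_rpow_half]
  gcongr
  set Z := ∑' k : {k : ℤ × ℤ // k ≠ 0}, ENNReal.ofReal
    ((((k.1.1 : ℝ) ^ 2 + (k.1.2 : ℝ) ^ 2) ^ s) * ‖torusFourierCoeff (partial1 g) k.1‖ ^ 2) with hZ
  have part : ∀ n : ℤ, (n : ℝ) ^ 2 = 1 → ∑' k : {k : ℤ // k ≠ 0},
      ENNReal.ofReal (((k.1 : ℝ) ^ 2 + 1) ^ s * ‖torusFourierCoeff (partial1 g) (k.1, n)‖ ^ 2)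
        ≤ Z := by
    intro n hn
    have hinj : Function.Injective fun k : {k : ℤ // k ≠ 0} =>
        (⟨(k.1, n), fun h => k.2 (congrArg Prod.fst h)⟩ : {k : ℤ × ℤ // k ≠ 0}) := by
      intro a b h
      exact Subtype.ext (congrArg (fun z => z.1.1) h)
    refine le_trans (le_of_eq ?_) (ENNReal.tsum_comp_le_tsum_of_injective hinj _)
    simp only [hn]
  have hpt : ∀ k : {k : ℤ // k ≠ 0}, ENNReal.ofReal (((k.1 : ℝ) ^ 2 + 1) ^ s *
      ‖modeCoeff (fun b => (sin b : ℂ)) (partial1 g) k.1‖ ^ 2) ≤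
      ENNReal.ofReal ((2 * π) ^ 4 / 2) *
        (ENNReal.ofReal (((k.1 : ℝ) ^ 2 + 1) ^ s * ‖torusFourierCoeff (partial1 g) (k.1, 1)‖ ^ 2)
        + ENNReal.ofReal (((k.1 : ℝ) ^ 2 + 1) ^ s *
          ‖torusFourierCoeff (partial1 g) (k.1, -1)‖ ^ 2)) := by
    intro k
    rw [← ENNReal.ofReal_add (by positivity) (by positivity), ← ENNReal.ofReal_mul (by positivity)]
    refine ENNReal.ofReal_le_ofReal ?_
    have := mul_le_mul_of_nonneg_left (sq_norm_modeCoeff_sin_le hg hp k.1)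
      (show 0 ≤ ((k.1 : ℝ) ^ 2 + 1) ^ s by positivity)
    linarith
  refine (ENNReal.tsum_le_tsum hpt).trans ?_
  rw [ENNReal.tsum_mul_left, ENNReal.tsum_add]
  calc _ ≤ ENNReal.ofReal ((2 * π) ^ 4 / 2) * (Z + Z) := by
        gcongr
        · exact part 1 (by norm_num)
        · exact part (-1) (by norm_num)
    _ = _ := by
        rw [← two_mul, ← mul_assoc, ← mul_assoc, ← ENNReal.ofReal_mul (by positivity),
          ← ENNReal.ofReal_ofNat 2, ← ENNReal.ofReal_mul (by positivity)]
        congr 2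
        ring

end

theorem IsStripSolution.isFlowFrom {ρ₀ : ℝ × ℝ → ℝ} {ρ : ℝ → ℝ × ℝ → ℝ}
    {u : ℝ → ℝ × ℝ → ℝ × ℝ} {p : ℝ → ℝ × ℝ → ℝ} (h : IsStripSolution ρ u p)
    (hinit : EqOn (ρ 0) ρ₀ strip) :
    IsFlowFrom ρ₀ (fun q => ρ q.1 q.2) (fun q => (u q.1 q.2).1) (fun q => (u q.1 q.2).2)
      (fun q => p q.1 q.2) :=
  ⟨h.isFlow, h.no_flow, h.periodic_ρ, hinit⟩

theorem IsStripSolution.contDiffOn_slice {ρ : ℝ → ℝ × ℝ → ℝ} {u : ℝ → ℝ × ℝ → ℝ × ℝ}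
    {p : ℝ → ℝ × ℝ → ℝ} (h : IsStripSolution ρ u p) {t : ℝ} (ht : 0 ≤ t) :
    ContDiffOn ℝ 1 (ρ t) strip :=
  h.isFlow.smooth_r.comp (f := fun x : ℝ × ℝ => (t, x)) (by fun_prop) fun _ hx => ⟨ht, hx⟩

/-- The growth statement on the strip, for any norm that is bounded below on the first sine mode
and for which `∂₁` is of order one. -/
theorem IsStripData.exists_growth {ρ₀ : ℝ × ℝ → ℝ} (h₀ : IsStripData ρ₀) {s : ℝ}
    (hs : -(1 / 2) < s) {nrm : ℝ → (ℝ × ℝ → ℝ) → ENNReal} {C₁ : ℝ} (hC₁ : 0 < C₁)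
    (hlow : ∀ g : ℝ × ℝ → ℝ, ContDiffOn ℝ 1 g strip → StripPeriodic g →
      weightedSum (s + 1) (modeCoeff (fun b => (sin b : ℂ)) g) ≤
        ENNReal.ofReal C₁ * nrm s (partial1 g) ^ (2 : ℝ))
    (hone : ∀ g : ℝ × ℝ → ℝ, ContDiffOn ℝ 1 g strip → StripPeriodic g →
      nrm s (partial1 g) ≤ nrm (s + 1) g) :
    ∃ C : NNReal, ∀ (ρ : ℝ → ℝ × ℝ → ℝ) (u : ℝ → ℝ × ℝ → ℝ × ℝ) (p : ℝ → ℝ × ℝ → ℝ),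
      IsStripSolution ρ u p → EqOn (ρ 0) ρ₀ strip →
        (∫⁻ t in Ioi (0 : ℝ), nrm s (partial1 (ρ t)) ^ (-(2 / (2 * s + 1)))) ≤ (C : ENNReal) ∧
        limsup (fun t : ℝ => ENNReal.ofReal (t ^ (-(s + 1 / 2))) * nrm s (partial1 (ρ t))) atTop
          ≤ limsup (fun t : ℝ => ENNReal.ofReal (t ^ (-(s + 1 / 2))) * nrm (s + 1) (ρ t)) atTop ∧
        limsup (fun t : ℝ => ENNReal.ofReal (t ^ (-(s + 1 / 2))) * nrm s (partial1 (ρ t))) atTop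
          = ⊤ := by
  obtain ⟨C, hC⟩ := h₀.exists_growth_bound hs hC₁
  refine ⟨C, fun ρ u p h hinit => ?_⟩
  obtain ⟨h1, h2⟩ := hC _ _ _ _ (fun t => nrm s (partial1 (ρ t))) (h.isFlowFrom hinit)
    fun t ht => hlow (ρ t) (h.contDiffOn_slice ht.le) (h.periodic_ρ t ht.le)
  refine ⟨h1, limsup_le_limsup ?_, h2⟩
  filter_upwards [eventually_ge_atTop 0] with t ht
  gcongr
  exact hone (ρ t) (h.contDiffOn_slice ht) (h.periodic_ρ t ht)

end IPM

theorem theorem1p2 :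
    -- the torus
    (∀ ρ₀ : ℝ × ℝ → ℝ, IPM.IsTorusData ρ₀ →
      (∀ s : ℝ, -(1 / 2) < s → ∃ C : NNReal,
        ∀ (ρ : ℝ → ℝ × ℝ → ℝ) (u : ℝ → ℝ × ℝ → ℝ × ℝ) (p : ℝ → ℝ × ℝ → ℝ),
          IPM.IsTorusSolution ρ u p → ρ 0 = ρ₀ →
            (∫⁻ t in Ioi (0 : ℝ),
              IPM.torusHNorm s (IPM.partial1 (ρ t)) ^ (-(2 / (2 * s + 1)))) ≤ (C : ENNReal) ∧
            limsup (fun t : ℝ => ENNReal.ofReal (t ^ (-(s + 1 / 2))) *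
                IPM.torusHNorm s (IPM.partial1 (ρ t))) atTop
              ≤ limsup (fun t : ℝ => ENNReal.ofReal (t ^ (-(s + 1 / 2))) *
                IPM.torusHNorm (s + 1) (ρ t)) atTop ∧
            limsup (fun t : ℝ => ENNReal.ofReal (t ^ (-(s + 1 / 2))) *
                IPM.torusHNorm s (IPM.partial1 (ρ t))) atTop = ⊤) ∧
      -- the torus solution is a solution in the strip
      (∀ (ρ : ℝ → ℝ × ℝ → ℝ) (u : ℝ → ℝ × ℝ → ℝ × ℝ) (p : ℝ → ℝ × ℝ → ℝ),
        IPM.IsTorusSolution ρ u p → ρ 0 = ρ₀ → IPM.IsStripSolution ρ u p)) ∧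
    -- the strip
    (∀ ρ₀ : ℝ × ℝ → ℝ, IPM.IsStripData ρ₀ →
      ∀ s : ℝ, -(1 / 2) < s → ∃ C : NNReal,
        ∀ (ρ : ℝ → ℝ × ℝ → ℝ) (u : ℝ → ℝ × ℝ → ℝ × ℝ) (p : ℝ → ℝ × ℝ → ℝ),
          IPM.IsStripSolution ρ u p → EqOn (ρ 0) ρ₀ IPM.strip →
            (∫⁻ t in Ioi (0 : ℝ),
              IPM.stripHNorm s (IPM.partial1 (ρ t)) ^ (-(2 / (2 * s + 1)))) ≤ (C : ENNReal) ∧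
            limsup (fun t : ℝ => ENNReal.ofReal (t ^ (-(s + 1 / 2))) *
                IPM.stripHNorm s (IPM.partial1 (ρ t))) atTop
              ≤ limsup (fun t : ℝ => ENNReal.ofReal (t ^ (-(s + 1 / 2))) *
                IPM.stripHNorm (s + 1) (ρ t)) atTop ∧
            limsup (fun t : ℝ => ENNReal.ofReal (t ^ (-(s + 1 / 2))) *
                IPM.stripHNorm s (IPM.partial1 (ρ t))) atTop = ⊤) := by
  refine ⟨fun ρ₀ h₀ => ⟨fun s hs => ?_, fun ρ u p h hinit => h.isStripSolution h₀ hinit⟩,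
    fun ρ₀ h₀ s hs => ?_⟩
  · obtain ⟨C, hC⟩ := h₀.isStripData.exists_growth hs (nrm := IPM.torusHNorm)
      (C₁ := max 1 (2 ^ (-s)) * (2 * π) ^ 2) (by positivity)
      (fun g hg hp => IPM.weightedSum_le_torusHNorm hg hp s)
      (fun g hg hp => IPM.torusHNorm_partial1_le hg hp s)
    exact ⟨C, fun ρ u p h hinit =>
      hC ρ u p (h.isStripSolution h₀ hinit) fun x _ => congrFun hinit x⟩
  · exact h₀.exists_growth hs (nrm := IPM.stripHNorm) (C₁ := max 1 (2 ^ (-s)) * (2 * π ^ 2))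
      (by positivity) (fun g hg hp => IPM.weightedSum_le_stripHNorm hg hp s)
      (fun g hg hp => IPM.stripHNorm_partial1_le hg hp s)
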